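/- Let $N\in\mathbb N$ and $M>0$. There is a constant $c$, depending only on $M$ and on the dimension $N$, with the following property. Let $\Omega\subset\mathbb R^N$ be a bounded domain, and let $\phi$ be a bi-Lipschitz map of $\Omega$ onto a domain $\tilde\Omega=\phi(\Omega)$ with $\|D\phi\|_{L^\infty(\Omega)}\le M$ and $\|(D\phi)^{-1}\|_{L^\infty(\Omega)}\le M$ (in operator norms); put $E=\{x\in\Omega:\phi(x)\ne x\}$ and let $|E|$ be its Lebesgue measure. Let $A=(A_{ij})$ be a measurable, real symmetric matrix-valued function on $\Omega\cup\tilde\Omega$ with $$\frac1M|\xi|^2\le\sum_{i,j}A_{ij}(x)\xi_i\xi_j\le M|\xi|^2,\qquad x\in\Omega\cup\tilde\Omega,\ \xi\in\mathbb R^N.$$ Let $f\in L^2(\Omega\cup\tilde\Omega)$ (real- or complex-valued) and let $u\in H^1_0(\Omega)$ and $\tilde u\in H^1_0(\tilde\Omega)$ be the weak solutions of the Dirichlet problems $-\sum_{i,j}\partial_{x_j}(A_{ij}\partial_{x_i}u)=f$ in $\Omega$ and $-\sum_{i,j}\partial_{x_j}(A_{ij}\partial_{x_i}\tilde u)=f$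 in $\tilde\Omega$. Assume that for some real $q>2$ $$\|f\|_{L^q(\Omega\cup\tilde\Omega)}\le M,\qquad \|\nabla u\|_{L^q(\Omega)}\le M,\qquad \|\nabla\tilde u\|_{L^q(\tilde\Omega)}\le M.$$ Then, with $\nabla u$ and $\nabla\tilde u$ extended by zero outside $\Omega$ and $\tilde\Omega$ respectively, $$\|\nabla\tilde u-\nabla u\|_{L^2(\Omega\cup\tilde\Omega)}\le c\,|E|^{\frac{q-2}{2q}}.$$ -/

import Mathlib

open MeasureTheory Filter Topology
open scoped ENNReal NNReal ContDiff

noncomputable section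

namespace DomainPerturbation

/-- Euclidean space `ℝ^N`, with its Euclidean norm and Lebesgue measure. -/
abbrev Space (N : ℕ) : Type := EuclideanSpace ℝ (Fin N)

/-- Vectors of `𝕜^N` with the Euclidean norm, the values of gradients of `𝕜`-valued functions. -/
abbrev Vec (𝕜 : Type) (N : ℕ) : Type := EuclideanSpace 𝕜 (Fin N)

/-- A bounded domain: a non-empty, open, connected and bounded subset of `ℝ^N`. -/
structure IsBoundedDomain {N : ℕ} (Ω : Set (Space N)) : Prop where
  isOpen : IsOpen Ω
  isConnected : IsConnected Ω
  isBounded : Bornology.IsBounded Ω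

/-- `φ` restricts to a bi-Lipschitz map of `Ω` onto `Ω'`. -/
structure IsBiLipschitzOnto {N : ℕ} (φ : Space N → Space N) (Ω Ω' : Set (Space N)) : Prop where
  image_eq : φ '' Ω = Ω'
  lipschitz : ∃ K : ℝ≥0, LipschitzOnWith K φ Ω
  antilipschitz : ∃ K : ℝ≥0, AntilipschitzWith K (Ω.domRestrict φ)

/-- `‖Dφ‖_{L^∞(Ω)} ≤ M` and `‖(Dφ)⁻¹‖_{L^∞(Ω)} ≤ M`, in operator norms.  If `φ` is bi-Lipschitz on
the open set `Ω`, then at almost every point of `Ω` it is differentiable with invertible derivative,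
so that the default values of `fderiv` and `inverse` play no role. -/
structure HasDerivBounds {N : ℕ} (φ : Space N → Space N) (Ω : Set (Space N)) (M : ℝ) : Prop where
  norm_fderiv_le : ∀ᵐ x ∂(volume.restrict Ω), ‖fderiv ℝ φ x‖ ≤ M
  norm_inverse_le : ∀ᵐ x ∂(volume.restrict Ω), ‖(fderiv ℝ φ x).inverse‖ ≤ M

/-- `A` is a real symmetric matrix-valued function, (Lebesgue) measurable on `U`, with
`M⁻¹ |ξ|² ≤ ∑ A_ij(x) ξ_i ξ_j ≤ M |ξ|²` for `x ∈ U`. -/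
structure IsEllipticOn {N : ℕ} (A : Space N → Matrix (Fin N) (Fin N) ℝ) (U : Set (Space N))
    (M : ℝ) : Prop where
  measurable : ∀ i j, AEMeasurable (fun x => A x i j) (volume.restrict U)
  symm : ∀ x ∈ U, (A x).IsSymm
  lower : ∀ x ∈ U, ∀ ξ : Space N, 1 / M * ‖ξ‖ ^ 2 ≤ ∑ i, ∑ j, A x i j * ξ i * ξ j
  upper : ∀ x ∈ U, ∀ ξ : Space N, ∑ i, ∑ j, A x i j * ξ i * ξ j ≤ M * ‖ξ‖ ^ 2

/-- `v ∈ C_c^∞(Ω)`, extended by zero. -/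
structure IsTestFunction {F : Type} [NormedAddCommGroup F] [NormedSpace ℝ F] {N : ℕ}
    (Ω : Set (Space N)) (v : Space N → F) : Prop where
  contDiff : ContDiff ℝ ∞ v
  hasCompactSupport : HasCompactSupport v
  tsupport_subset : tsupport v ⊆ Ω

/-- The classical gradient of a differentiable `𝕜`-valued function. -/
def grad {𝕜 : Type} [RCLike 𝕜] {N : ℕ} (v : Space N → 𝕜) (x : Space N) : Vec 𝕜 N :=
  WithLp.toLp 2 fun i => fderiv ℝ v x (EuclideanSpace.single i 1)

/-- `Du` is the weak gradient of `u` on `Ω`. It is used for `u` and `Du` in `L²(Ω)` only, where all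
these integrals converge. -/
def HasWeakGradient {𝕜 : Type} [RCLike 𝕜] {N : ℕ} (Ω : Set (Space N)) (u : Space N → 𝕜)
    (Du : Space N → Vec 𝕜 N) : Prop :=
  ∀ η : Space N → ℝ, IsTestFunction Ω η → ∀ i : Fin N,
    ∫ x in Ω, fderiv ℝ η x (EuclideanSpace.single i 1) • u x = - ∫ x in Ω, η x • Du x i

/-- `u ∈ H¹₀(Ω)` with weak gradient `Du`: `u` belongs to `H¹(Ω)` and is the limit in `H¹(Ω)` of a
sequence in `C_c^∞(Ω)`. -/
structure MemH10 {𝕜 : Type} [RCLike 𝕜] {N : ℕ} (Ω : Set (Space N)) (u : Space N → 𝕜)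
    (Du : Space N → Vec 𝕜 N) : Prop where
  memLp : MemLp u 2 (volume.restrict Ω)
  memLp_grad : MemLp Du 2 (volume.restrict Ω)
  hasWeakGradient : HasWeakGradient Ω u Du
  exists_approx : ∃ v : ℕ → Space N → 𝕜, (∀ n, IsTestFunction Ω (v n)) ∧
    Tendsto (fun n => eLpNorm (v n - u) 2 (volume.restrict Ω)) atTop (𝓝 0) ∧
    Tendsto (fun n => eLpNorm (grad (v n) - Du) 2 (volume.restrict Ω)) atTop (𝓝 0)

/-- `u`, with weak gradient `Du`, is the solution of `-∑ ∂_j (A_ij ∂_i u) = f` on `Ω` subject to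
Dirichlet boundary conditions: `u ∈ H¹₀(Ω)`, and
`∫_Ω ∑ A_ij ∂_i u conj(∂_j v) dx = ∫_Ω f conj(v) dx` for all `v ∈ H¹₀(Ω)`. -/
structure IsDirichletSolution {𝕜 : Type} [RCLike 𝕜] {N : ℕ}
    (A : Space N → Matrix (Fin N) (Fin N) ℝ) (f : Space N → 𝕜) (Ω : Set (Space N))
    (u : Space N → 𝕜) (Du : Space N → Vec 𝕜 N) : Prop where
  memH10 : MemH10 Ω u Du
  weak_eq : ∀ (v : Space N → 𝕜) (Dv : Space N → Vec 𝕜 N), MemH10 Ω v Dv →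
    ∫ x in Ω, ∑ i, ∑ j, (A x i j : 𝕜) * Du x i * (starRingEnd 𝕜) (Dv x j)
      = ∫ x in Ω, f x * (starRingEnd 𝕜) (v x)

end DomainPerturbation

end

/-! Write `T` for the difference of the two gradients, extended by zero. A function admissible on
both domains tests both equations with the same right-hand side, so `T` is orthogonal in the energy
form to the gradient of every Lipschitz function with compact support in `Ω ∩ Ω'`. By Céa's lemma
`T` is then bounded by its distance to such gradients, and it suffices to approximate each of the
two gradients separately.

Let `v` be a test function on `Ω` close to `u`, and let `ψ` be the inverse of `φ`. The competitor is
the median of `v`, of `v ∘ ψ` extended by zero, and of `0`. It is Lipschitz, vanishes where either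
of the first two does, and equals `v` off `E`, where the two agree. So its gradient differs from
that of `v` only on `E`. There the transplanted gradient at a point of `Ω'` is controlled by the
gradient of `v` at `ψ x`, again a point of `E`; a change of variables bounds the whole error by the
`L²(E)` norm of the gradient of `v` (`eLpNorm_grad_sub_truncation_le`).

Letting `v` tend to `u` (`eLpNorm_sub_le_of_isLipschitzPair`) leaves only the `L²` norms of the
gradients on `E` and on `φ '' E`. Hölder's inequality with the `L^q` bounds, and `|φ(E)| ≤ M^N |E|`,
give the power of `|E|`. -/

namespace DomainPerturbation

/-! ### Bi-Lipschitz maps: inverse, change of variables, moved points. -/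

/-- A Lipschitz map of a Euclidean space into itself maps null sets to null sets. -/
theorem volume_image_eq_zero_of_lipschitzOnWith {N : ℕ} {K : ℝ≥0} {φ : Space N → Space N}
    {s : Set (Space N)} (hφ : LipschitzOnWith K φ s) (hs : volume s = 0) :
    volume (φ '' s) = 0 := by
  have hN : ((Module.finrank ℝ (Space N) : ℕ) : ℝ) = N := by simp
  have : (Measure.hausdorffMeasure (N : ℝ) : Measure (Space N)).IsAddHaarMeasure := by
    rw [← hN]; infer_instance
  have h1 : (Measure.hausdorffMeasure (N : ℝ) : Measure (Space N)) s = 0 :=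
    Measure.absolutelyContinuous_isAddHaarMeasure _ volume hs
  apply Measure.absolutelyContinuous_isAddHaarMeasure volume
    (Measure.hausdorffMeasure (N : ℝ) : Measure (Space N))
  have h2 := hφ.hausdorffMeasure_image_le (d := (N : ℝ)) (by positivity)
  rw [h1, mul_zero] at h2
  exact le_antisymm h2 bot_le

/-- The unit ball is mapped into the ball of radius `‖L‖`; compare volumes. -/
theorem abs_det_le_norm_pow {N : ℕ} (L : Space N →L[ℝ] Space N) : |L.det| ≤ ‖L‖ ^ N := by
  have h1 : volume (L '' Metric.ball 0 1) =
      ENNReal.ofReal |L.det| * volume (Metric.ball (0 : Space N) 1) :=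
    Measure.addHaar_image_continuousLinearMap volume L _
  have h2 : L '' Metric.ball 0 1 ⊆ Metric.closedBall 0 ‖L‖ := by
    rintro _ ⟨x, hx, rfl⟩
    rw [mem_closedBall_zero_iff]
    rw [mem_ball_zero_iff] at hx
    exact (L.le_opNorm x).trans (mul_le_of_le_one_right (norm_nonneg _) hx.le)
  have h3 := measure_mono (μ := volume) h2
  rw [h1, Measure.addHaar_closedBall volume _ (norm_nonneg _)] at h3
  have h4 := (ENNReal.mul_le_mul_iff_left (Metric.measure_ball_pos volume (0 : Space N) one_pos).ne'
    measure_ball_lt_top.ne).1 h3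
  simpa using (ENNReal.ofReal_le_ofReal_iff (by positivity)).1 h4

/-- `φ` and `ψ` are mutually inverse Lipschitz maps between the open sets `Ω` and `Ω'`, with
derivatives bounded by `M` almost everywhere. -/
structure IsLipschitzPair {N : ℕ} (φ ψ : Space N → Space N) (Ω Ω' : Set (Space N)) (M : ℝ) :
    Prop where
  isOpen_source : IsOpen Ω
  isOpen_target : IsOpen Ω'
  mapsTo : Set.MapsTo φ Ω Ω'
  mapsTo_symm : Set.MapsTo ψ Ω' Ω
  leftInvOn : Set.LeftInvOn ψ φ Ω
  rightInvOn : Set.LeftInvOn φ ψ Ω'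
  lipschitz : ∃ K : ℝ≥0, LipschitzOnWith K φ Ω
  lipschitz_symm : ∃ K : ℝ≥0, LipschitzOnWith K ψ Ω'
  norm_fderiv_le : ∀ᵐ x ∂(volume.restrict Ω), ‖fderiv ℝ φ x‖ ≤ M
  norm_fderiv_symm_le : ∀ᵐ x ∂(volume.restrict Ω'), ‖fderiv ℝ ψ x‖ ≤ M

theorem ae_differentiableAt_of_lipschitzOnWith {N : ℕ} {F : Type*} [NormedAddCommGroup F]
    [NormedSpace ℝ F] [FiniteDimensional ℝ F] {φ : Space N → F}
    {Ω : Set (Space N)} {K : ℝ≥0} (hΩ : IsOpen Ω) (hφ : LipschitzOnWith K φ Ω) :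
    ∀ᵐ x ∂(volume.restrict Ω), DifferentiableAt ℝ φ x := by
  rw [ae_restrict_iff' hΩ.measurableSet]
  filter_upwards [hφ.ae_differentiableWithinAt_of_mem (μ := volume)] with x hx hxΩ
  exact (hx hxΩ).differentiableAt (hΩ.mem_nhds hxΩ)

namespace IsLipschitzPair

variable {N : ℕ} {φ ψ : Space N → Space N} {Ω Ω' : Set (Space N)} {M : ℝ}

theorem symm (h : IsLipschitzPair φ ψ Ω Ω' M) : IsLipschitzPair ψ φ Ω' Ω M :=
  ⟨h.2, h.1, h.4, h.3, h.6, h.5, h.8, h.7, h.10, h.9⟩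

theorem image_eq_preimage (h : IsLipschitzPair φ ψ Ω Ω' M) {s : Set (Space N)} (hs : s ⊆ Ω) :
    φ '' s = {y ∈ Ω' | ψ y ∈ s} := by
  ext y
  constructor
  · rintro ⟨x, hx, rfl⟩
    exact ⟨h.mapsTo (hs hx), by rwa [h.leftInvOn (hs hx)]⟩
  · rintro ⟨hy, hs⟩
    exact ⟨ψ y, hs, h.rightInvOn hy⟩

/-- The area formula applies off a null set of bad points, whose image is null because `φ` is
Lipschitz; the Jacobian is at most `M ^ N`. -/
theorem lintegral_image_le (h : IsLipschitzPair φ ψ Ω Ω' M) {s : Set (Space N)}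
    (hsm : MeasurableSet s) (hs : s ⊆ Ω) (g : Space N → ℝ≥0∞) :
    ∫⁻ y in φ '' s, g y ≤ ENNReal.ofReal (M ^ N) * ∫⁻ x in s, g (φ x) := by
  obtain ⟨K, hK⟩ := h.lipschitz
  have hgood : ∀ᵐ x ∂(volume.restrict s), DifferentiableAt ℝ φ x ∧ ‖fderiv ℝ φ x‖ ≤ M := by
    have := (ae_differentiableAt_of_lipschitzOnWith h.isOpen_source hK).and h.norm_fderiv_le
    exact ae_restrict_of_ae_restrict_of_subset hs this
  rw [ae_restrict_iff' hsm] at hgood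
  obtain ⟨t, htsub, htm, ht⟩ := exists_measurable_superset_of_null (ae_iff.1 hgood)
  have hst : s \ t ⊆ Ω := Set.sdiff_subset.trans hs
  have hd : ∀ x ∈ s \ t, DifferentiableAt ℝ φ x ∧ ‖fderiv ℝ φ x‖ ≤ M := by
    intro x hx
    by_contra hcon
    exact hx.2 (htsub fun h => hcon (h hx.1))
  have hnull : volume (φ '' (s ∩ t)) = 0 :=
    volume_image_eq_zero_of_lipschitzOnWith (hK.mono (Set.inter_subset_left.trans hs))
      (measure_mono_null Set.inter_subset_right ht)
  calc ∫⁻ y in φ '' s, g y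
      ≤ ∫⁻ y in φ '' (s \ t) ∪ φ '' (s ∩ t), g y := by
        rw [← Set.image_union, Set.sdiff_union_inter]
    _ ≤ (∫⁻ y in φ '' (s \ t), g y) + ∫⁻ y in φ '' (s ∩ t), g y := lintegral_union_le _ _ _
    _ = ∫⁻ y in φ '' (s \ t), g y := by rw [setLIntegral_measure_zero _ _ hnull, add_zero]
    _ = ∫⁻ x in s \ t, ENNReal.ofReal |(fderiv ℝ φ x).det| * g (φ x) :=
        lintegral_image_eq_lintegral_abs_det_fderiv_mul volume (hsm.diff htm)
          (fun x hx => (hd x hx).1.hasFDerivAt.hasFDerivWithinAt) (h.leftInvOn.injOn.mono hst) g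
    _ ≤ ∫⁻ x in s \ t, ENNReal.ofReal (M ^ N) * g (φ x) := by
        refine setLIntegral_mono' (hsm.diff htm) fun x hx => ?_
        gcongr
        exact (abs_det_le_norm_pow _).trans (pow_le_pow_left₀ (norm_nonneg _) (hd x hx).2 _)
    _ ≤ ∫⁻ x in s, ENNReal.ofReal (M ^ N) * g (φ x) := lintegral_mono_set Set.sdiff_subset
    _ = _ := lintegral_const_mul' _ _ ENNReal.ofReal_ne_top

theorem volume_image_le (h : IsLipschitzPair φ ψ Ω Ω' M) {s : Set (Space N)}
    (hsm : MeasurableSet s) (hs : s ⊆ Ω) :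
    volume (φ '' s) ≤ ENNReal.ofReal (M ^ N) * volume s := by
  simpa using h.lintegral_image_le hsm hs fun _ => 1

theorem isOpen_moved (h : IsLipschitzPair φ ψ Ω Ω' M) : IsOpen {x ∈ Ω | φ x ≠ x} := by
  obtain ⟨K, hK⟩ := h.lipschitz
  have := (hK.continuousOn.prodMk continuousOn_id).isOpen_inter_preimage h.isOpen_source
    (isClosed_diagonal (X := Space N)).isOpen_compl
  have e : {x ∈ Ω | φ x ≠ x} = Ω ∩ (fun x => (φ x, id x)) ⁻¹' (Set.diagonal (Space N))ᶜ := by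
    ext x
    simp
  rw [e]
  exact this

theorem image_moved (h : IsLipschitzPair φ ψ Ω Ω' M) :
    φ '' {x ∈ Ω | φ x ≠ x} = {y ∈ Ω' | ψ y ≠ y} := by
  rw [h.image_eq_preimage (Set.sep_subset _ _)]
  ext y
  simp only [Set.mem_ofPred_eq]
  refine and_congr_right fun hy => ?_
  rw [h.rightInvOn hy]
  exact ⟨fun H => H.2.symm, fun H => ⟨h.mapsTo_symm hy, H.symm⟩⟩

end IsLipschitzPair

/-- At almost every point the derivative of the inverse map is the inverse of the derivative of `φ`,
which turns the bound on `(Dφ)⁻¹` into one on `Dψ`. -/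
theorem exists_isLipschitzPair {N : ℕ} {φ : Space N → Space N} {Ω Ω' : Set (Space N)} {M : ℝ}
    (hΩ : IsOpen Ω) (hΩ' : IsOpen Ω') (hφ : IsBiLipschitzOnto φ Ω Ω')
    (hM : HasDerivBounds φ Ω M) : ∃ ψ, IsLipschitzPair φ ψ Ω Ω' M := by
  obtain ⟨K, hK⟩ := hφ.lipschitz
  obtain ⟨K', hK'⟩ := hφ.antilipschitz
  have hanti : ∀ x ∈ Ω, ∀ y ∈ Ω, dist x y ≤ K' * dist (φ x) (φ y) := fun x hx y hy => by
    exact hK'.le_mul_dist ⟨x, hx⟩ ⟨y, hy⟩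
  have hinj : Set.InjOn φ Ω := fun x hx y hy hxy => by
    have := hanti x hx y hy
    rw [hxy, dist_self, mul_zero] at this
    exact dist_le_zero.1 this
  set ψ := Function.invFunOn φ Ω
  have hl : Set.LeftInvOn ψ φ Ω := hinj.leftInvOn_invFunOn
  have hmaps : Set.MapsTo φ Ω Ω' := fun x hx => hφ.image_eq ▸ Set.mem_image_of_mem φ hx
  have hsurj : Set.SurjOn φ Ω Ω' := hφ.image_eq.ge
  have hr : Set.LeftInvOn φ ψ Ω' := hsurj.rightInvOn_invFunOn
  have hmaps' : Set.MapsTo ψ Ω' Ω := hsurj.mapsTo_invFunOn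
  have hψ : LipschitzOnWith K' ψ Ω' := LipschitzOnWith.of_dist_le_mul fun x hx y hy => by
    have := hanti _ (hmaps' hx) _ (hmaps' hy)
    rwa [hr hx, hr hy] at this
  refine ⟨ψ, hΩ, hΩ', hmaps, hmaps', hl, hr, ⟨K, hK⟩, ⟨K', hψ⟩, hM.norm_fderiv_le, ?_⟩
  have hgood := (ae_differentiableAt_of_lipschitzOnWith hΩ hK).and hM.norm_inverse_le
  rw [ae_restrict_iff' hΩ.measurableSet, ae_iff] at hgood
  have hsub : {x | ¬(x ∈ Ω → DifferentiableAt ℝ φ x ∧ ‖(fderiv ℝ φ x).inverse‖ ≤ M)} ⊆ Ω :=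
    fun y hy => by
      by_contra hy'
      exact hy fun h => absurd h hy'
  rw [ae_restrict_iff' hΩ'.measurableSet, ae_iff]
  -- The bad points in `Ω'` are images of bad points in `Ω`, a null set.
  refine measure_mono_null ?_ (volume_image_eq_zero_of_lipschitzOnWith (hK.mono hsub) hgood)
  intro y hy
  simp only [Set.mem_ofPred_eq, Classical.not_imp] at hy
  obtain ⟨hyΩ, hy⟩ := hy
  refine ⟨ψ y, ?_, hr hyΩ⟩
  intro hcon
  obtain ⟨hd, hbd⟩ := hcon (hmaps' hyΩ)
  apply hy
  have hx := hmaps' hyΩ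
  -- If the derivative killed `v ≠ 0`, then `φ` would move by `o(t)` along `t • v`, against the
  -- lower Lipschitz bound. This excludes the default value `0` of `inverse` at a singular
  -- derivative.
  have hker : Function.Injective (fderiv ℝ φ (ψ y)) := by
    have hnear : ∀ᶠ z in 𝓝 (ψ y), ‖z - ψ y‖ ≤ K' * ‖φ z - φ (ψ y)‖ := by
      filter_upwards [hΩ.mem_nhds hx] with z hz
      simpa [dist_eq_norm] using hanti z hz _ hx
    rw [injective_iff_map_eq_zero]
    intro v hv
    have hl : HasLineDerivAt ℝ φ (fderiv ℝ φ (ψ y) v) (ψ y) v := hd.hasFDerivAt.hasLineDerivAt v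
    rw [hv] at hl
    have ho := (hasDerivAt_iff_isLittleO_nhds_zero.1 hl)
    simp only [zero_add, zero_smul, add_zero, smul_zero, sub_zero] at ho
    have htend : Tendsto (fun t : ℝ => ψ y + t • v) (𝓝 0) (𝓝 (ψ y)) := by
      have : Continuous fun t : ℝ => ψ y + t • v := by fun_prop
      simpa using this.tendsto 0
    have hO : (fun t : ℝ => t • v) =O[𝓝 0] fun t : ℝ => φ (ψ y + t • v) - φ (ψ y) := by
      refine Asymptotics.IsBigO.of_bound K' ?_
      filter_upwards [htend.eventually hnear] with t ht
      simpa using ht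
    have hlo := hO.trans_isLittleO ho
    by_contra hv0
    have := (hlo.def (c := ‖v‖ / 2) (by positivity))
    have h2 : ∀ᶠ t in 𝓝[≠] (0 : ℝ), ‖t • v‖ ≤ ‖v‖ / 2 * ‖t‖ := this.filter_mono nhdsWithin_le_nhds
    obtain ⟨t, ht, ht0⟩ := (h2.and self_mem_nhdsWithin).exists
    rw [norm_smul] at ht
    have ht0' : 0 < ‖t‖ := norm_pos_iff.2 ht0
    have hv0' : 0 < ‖v‖ := norm_pos_iff.2 hv0
    nlinarith [mul_pos ht0' hv0']
  let e : Space N ≃L[ℝ] Space N :=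
    (LinearEquiv.ofInjectiveEndo (fderiv ℝ φ (ψ y)).toLinearMap hker).toContinuousLinearEquiv
  have he : (e : Space N →L[ℝ] Space N) = fderiv ℝ φ (ψ y) := by
    ext; rfl
  have hdψ : HasFDerivAt ψ (e.symm : Space N →L[ℝ] Space N) y := by
    refine HasFDerivAt.of_local_left_inverse (hψ.continuousOn.continuousAt (hΩ'.mem_nhds hyΩ))
      (he ▸ hd.hasFDerivAt) ?_
    filter_upwards [hΩ'.mem_nhds hyΩ] with z hz using hr hz
  rw [hdψ.fderiv]
  rwa [← he, ContinuousLinearMap.inverse_equiv] at hbd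

end DomainPerturbation

namespace DomainPerturbation

open scoped Convolution

/-! ### Compactly supported Lipschitz functions: gradients, mollification, membership in `H¹₀`. -/

section LTwo

variable {α F : Type*} [MeasurableSpace α] {μ : Measure α} [NormedAddCommGroup F]

theorem eLpNorm_two_eq (f : α → F) : eLpNorm f 2 μ = (∫⁻ x, ‖f x‖ₑ ^ 2 ∂μ) ^ (1 / 2 : ℝ) := by
  rw [eLpNorm_eq_lintegral_rpow_enorm_toReal (by norm_num) (by norm_num)]
  simp

/-- Bounded convergence in `L²` for functions vanishing outside a fixed set of finite measure. -/
theorem tendsto_eLpNorm_two_of_bounded {f : ℕ → α → F} {g : α → F} {S : Set α} {C : ℝ}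
    (hS : MeasurableSet S) (hμS : μ S ≠ ⊤) (hf : ∀ n, AEStronglyMeasurable (f n) μ)
    (hg : AEStronglyMeasurable g μ) (hfC : ∀ n x, ‖f n x‖ ≤ C) (hgC : ∀ x, ‖g x‖ ≤ C)
    (hfS : ∀ᶠ n in atTop, ∀ x ∉ S, f n x = 0) (hgS : ∀ x ∉ S, g x = 0)
    (hlim : ∀ᵐ x ∂μ, Tendsto (fun n => f n x) atTop (𝓝 (g x))) :
    Tendsto (fun n => eLpNorm (f n - g) 2 μ) atTop (𝓝 0) := by
  obtain ⟨n₀, hn₀⟩ := eventually_atTop.1 hfS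
  rw [← tendsto_add_atTop_iff_nat n₀]
  simp_rw [eLpNorm_two_eq]
  have key : Tendsto (fun n => ∫⁻ x, ‖(f (n + n₀) - g) x‖ₑ ^ 2 ∂μ) atTop (𝓝 (∫⁻ _, 0 ∂μ)) := by
    refine tendsto_lintegral_of_dominated_convergence'
      (S.indicator fun _ => ENNReal.ofReal ((C + C) ^ 2)) (fun n => ?_) (fun n => ?_) ?_ ?_
    · exact ((hf _).sub hg).enorm.pow_const 2
    · refine Eventually.of_forall fun x => ?_
      by_cases hx : x ∈ S
      · simp only [Set.indicator_of_mem hx, Pi.sub_apply]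
        rw [← ofReal_norm, ← ENNReal.ofReal_pow (norm_nonneg _)]
        gcongr
        exact (norm_sub_le _ _).trans (add_le_add (hfC _ _) (hgC _))
      · simp [hn₀ (n + n₀) (by simp) x hx, hgS x hx]
    · rw [lintegral_indicator_const hS]
      exact ENNReal.mul_ne_top ENNReal.ofReal_ne_top hμS
    · filter_upwards [hlim] with x hx
      have h1 : Tendsto (fun n => f (n + n₀) x - g x) atTop (𝓝 0) := by
        simpa using ((tendsto_add_atTop_iff_nat n₀).2 hx).sub_const (g x)
      have h2 := (ENNReal.continuous_pow 2).tendsto _ |>.comp h1.enorm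
      simpa [Function.comp_def] using h2
  rw [lintegral_zero] at key
  have := (ENNReal.continuous_rpow_const (y := (1 / 2 : ℝ))).tendsto 0 |>.comp key
  simpa [Function.comp_def] using this

end LTwo

variable {𝕜 : Type} [RCLike 𝕜] {N : ℕ}

/-- The vector of partial derivatives, as a linear function of the differential. -/
noncomputable def partials (𝕜 : Type) [RCLike 𝕜] (N : ℕ) : (Space N →L[ℝ] 𝕜) →ₗ[ℝ] Vec 𝕜 N where
  toFun L := WithLp.toLp 2 fun i => L (EuclideanSpace.single i 1)
  map_add' _ _ := rfl
  map_smul' c L := by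
    ext i
    simp [RCLike.real_smul_eq_coe_mul]

theorem partials_apply (L : Space N →L[ℝ] 𝕜) (i : Fin N) :
    partials 𝕜 N L i = L (EuclideanSpace.single i 1) := rfl

theorem grad_eq_partials (v : Space N → 𝕜) (x : Space N) :
    grad v x = partials 𝕜 N (fderiv ℝ v x) := rfl

theorem norm_partials_le (L : Space N →L[ℝ] 𝕜) : ‖partials 𝕜 N L‖ ≤ N * ‖L‖ := by
  have h : partials 𝕜 N L =
      ∑ i, EuclideanSpace.single i (L (EuclideanSpace.single i 1)) := by
    ext j
    simp [partials_apply, Finset.sum_apply, Pi.single_apply]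
  rw [h]
  refine (norm_sum_le _ _).trans ?_
  calc ∑ i : Fin N, ‖(EuclideanSpace.single i (L (EuclideanSpace.single i 1)) : Vec 𝕜 N)‖
      ≤ ∑ _i : Fin N, ‖L‖ := by
        gcongr with i
        simpa using L.le_opNorm (EuclideanSpace.single i 1)
    _ = _ := by simp

theorem norm_le_norm_partials (L : Space N →L[ℝ] 𝕜) : ‖L‖ ≤ N * ‖partials 𝕜 N L‖ := by
  refine L.opNorm_le_bound (by positivity) fun ξ => ?_
  have h : ξ = ∑ i, ξ i • (EuclideanSpace.single i (1 : ℝ) : Space N) := by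
    ext j
    simp [Finset.sum_apply, Pi.single_apply]
  calc ‖L ξ‖ = ‖∑ i, ξ i • partials 𝕜 N L i‖ := by
        conv_lhs => rw [h]
        simp [partials_apply]
    _ ≤ ∑ i, ‖ξ i • partials 𝕜 N L i‖ := norm_sum_le _ _
    _ ≤ ∑ _i : Fin N, ‖partials 𝕜 N L‖ * ‖ξ‖ := by
        gcongr with i
        rw [norm_smul, mul_comm]
        gcongr
        · exact PiLp.norm_apply_le _ _
        · exact PiLp.norm_apply_le _ _
    _ = _ := by simp [mul_assoc]

theorem norm_grad_le (v : Space N → 𝕜) (x : Space N) : ‖grad v x‖ ≤ N * ‖fderiv ℝ v x‖ :=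
  norm_partials_le _

theorem norm_fderiv_le_grad (v : Space N → 𝕜) (x : Space N) :
    ‖fderiv ℝ v x‖ ≤ N * ‖grad v x‖ :=
  norm_le_norm_partials _

theorem continuous_partials : Continuous (partials 𝕜 N) :=
  AddMonoidHomClass.continuous_of_bound (partials 𝕜 N) N norm_partials_le

theorem measurable_grad (v : Space N → 𝕜) : Measurable (grad v) :=
  continuous_partials.measurable.comp (measurable_fderiv ℝ v)

theorem aestronglyMeasurable_grad (v : Space N → 𝕜) (μ : Measure (Space N)) :
    AEStronglyMeasurable (grad v) μ :=
  (measurable_grad v).aestronglyMeasurable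

theorem grad_eq_zero_of_notMem_tsupport {v : Space N → 𝕜} {x : Space N} (hx : x ∉ tsupport v) :
    grad v x = 0 := by
  rw [grad_eq_partials, fderiv_of_notMem_tsupport _ hx, map_zero]

theorem norm_grad_le_of_lipschitzWith {K : ℝ≥0} {v : Space N → 𝕜} (hv : LipschitzWith K v)
    (x : Space N) : ‖grad v x‖ ≤ N * K :=
  (norm_grad_le v x).trans (by gcongr; exact norm_fderiv_le_of_lipschitz ℝ hv)

theorem hasCompactSupport_grad {v : Space N → 𝕜} (hv : HasCompactSupport v) :
    HasCompactSupport (grad v) :=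
  hv.mono' fun x hx => by
    by_contra h
    exact hx (grad_eq_zero_of_notMem_tsupport h)

theorem memLp_grad {K : ℝ≥0} {v : Space N → 𝕜} (hv : LipschitzWith K v)
    (hc : HasCompactSupport v) (p : ℝ≥0∞) (μ : Measure (Space N)) [IsFiniteMeasureOnCompacts μ] :
    MemLp (grad v) p μ :=
  (hasCompactSupport_grad hc).memLp_of_bound (aestronglyMeasurable_grad _ _) (N * K)
    (Eventually.of_forall (norm_grad_le_of_lipschitzWith hv))

/-- The differential of the mollification of a Lipschitz function is the mollification of its
almost everywhere defined differential. -/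
theorem fderiv_convolution_of_lipschitzWith {K : ℝ≥0} {w : Space N → 𝕜} (hw : LipschitzWith K w)
    {ρ : Space N → ℝ} (hρ : Continuous ρ) (hρc : HasCompactSupport ρ) (x : Space N) :
    fderiv ℝ (ρ ⋆[ContinuousLinearMap.lsmul ℝ ℝ, volume] w) x =
      (ρ ⋆[ContinuousLinearMap.lsmul ℝ ℝ, volume] fderiv ℝ w) x := by
  have hint : Integrable ρ := hρ.integrable_of_hasCompactSupport hρc
  have := (hasFDerivAt_integral_of_dominated_loc_of_lip (μ := (volume : Measure (Space N)))
    (F := fun y t => ρ t • w (y - t)) (F' := fun t => ρ t • fderiv ℝ w (x - t)) (x₀ := x)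
    (bound := fun t => ‖ρ t‖ * K) univ_mem ?_ ?_ ?_ ?_ ?_ ?_).2
  · exact this.fderiv
  · exact Eventually.of_forall fun y =>
      (hρ.smul (hw.continuous.comp (by fun_prop))).aestronglyMeasurable
  · exact (hρ.smul (hw.continuous.comp (by fun_prop))).integrable_of_hasCompactSupport
      hρc.smul_right
  · exact (hρ.measurable.smul ((measurable_fderiv ℝ w).comp (by fun_prop))).aestronglyMeasurable
  · refine Eventually.of_forall fun t => (LipschitzWith.of_dist_le_mul fun y z => ?_).lipschitzOnWith
    rw [dist_eq_norm, ← smul_sub, norm_smul, ← dist_eq_norm]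
    have h1 := hw.dist_le_mul (y - t) (z - t)
    rw [dist_sub_right] at h1
    rw [Real.coe_nnabs, abs_of_nonneg (by positivity), mul_assoc]
    gcongr
  · exact hint.norm.mul_const _
  -- For fixed `x`, `w` is differentiable at `x - t` for almost every `t`, since `t ↦ x - t`
  -- preserves Lebesgue measure.
  · have hd := hw.ae_differentiableAt (μ := (volume : Measure (Space N)))
    have hq := (Measure.measurePreserving_sub_left (volume : Measure (Space N))
      x).quasiMeasurePreserving.ae hd
    filter_upwards [hq] with t ht
    have h1 : HasFDerivAt (fun y => w (y - t)) (fderiv ℝ w (x - t)) x := by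
      have := ht.hasFDerivAt.comp x ((hasFDerivAt_id x).sub_const t)
      rwa [ContinuousLinearMap.comp_id] at this
    exact h1.const_smul (ρ t)

/-- Lipschitz functions with compact support have their pointwise gradient as weak gradient. -/
theorem hasWeakGradient_of_lipschitzWith {K : ℝ≥0} {w : Space N → 𝕜} {U : Set (Space N)}
    (hw : LipschitzWith K w) (hc : HasCompactSupport w) : HasWeakGradient U w (grad w) := by
  intro η hη i
  have hηc : Continuous η := hη.contDiff.continuous
  obtain ⟨D, hD⟩ := hη.contDiff.lipschitzWith_of_hasCompactSupport
    hη.hasCompactSupport (by simp)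
  have hηd : Differentiable ℝ η := hη.contDiff.differentiable (by simp)
  set e : Space N := EuclideanSpace.single i 1
  have hz : ∀ x ∉ U, x ∉ tsupport η := fun x hx h => hx (hη.tsupport_subset h)
  rw [setIntegral_eq_integral_of_forall_compl_eq_zero,
    setIntegral_eq_integral_of_forall_compl_eq_zero]
  rotate_left
  · intro x hx
    rw [image_eq_zero_of_notMem_tsupport (hz x hx), zero_smul]
  · intro x hx
    rw [fderiv_of_notMem_tsupport _ (hz x hx), zero_apply, zero_smul]
  have hi1 : Integrable fun x => fderiv ℝ η x e • w x := by
    have hsupp : HasCompactSupport fun x => fderiv ℝ η x e • w x := hc.mono fun x hx h => hx (by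
      simp only [h, smul_zero])
    refine Continuous.integrable_of_hasCompactSupport ?_ hsupp
    exact ((hη.contDiff.continuous_fderiv (by simp)).clm_apply continuous_const).smul hw.continuous
  have hi2 : Integrable fun x => η x • grad w x i := by
    have hg : Integrable (fun x => η x • grad w x) :=
      (memLp_one_iff_integrable.1 (memLp_grad hw hc 1 volume)).bdd_smul (⨆ x, ‖η x‖)
        hηc.aestronglyMeasurable (Eventually.of_forall fun x =>
          le_ciSup (hηc.norm.bddAbove_range_of_hasCompactSupport hη.hasCompactSupport.norm) x)
    refine hg.mono ((hηc.measurable.smul ?_).aestronglyMeasurable) ?_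
    · exact (EuclideanSpace.proj i : Vec 𝕜 N →L[𝕜] 𝕜).continuous.measurable.comp (measurable_grad w)
    · refine Eventually.of_forall fun x => ?_
      rw [norm_smul, norm_smul]
      gcongr
      exact PiLp.norm_apply_le _ _
  -- Real functionals reduce the identity to integration by parts for real-valued Lipschitz
  -- functions; real and imaginary parts then suffice.
  have key : ∀ ℓ : 𝕜 →L[ℝ] ℝ,
      ℓ (∫ x, fderiv ℝ η x e • w x) = ℓ (-∫ x, η x • grad w x i) := by
    intro ℓ
    rw [map_neg, ← ℓ.integral_comp_comm hi1, ← ℓ.integral_comp_comm hi2]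
    have hp := (ℓ.lipschitz.comp hw).integral_lineDeriv_mul_eq (μ := volume) hD
      hη.hasCompactSupport e
    have e1 : ∫ x, lineDeriv ℝ (ℓ ∘ w) x e * η x = ∫ x, ℓ (η x • grad w x i) := by
      refine integral_congr_ae ?_
      filter_upwards [hw.ae_differentiableAt (μ := (volume : Measure (Space N)))] with x hx
      have : HasFDerivAt (ℓ ∘ w) (ℓ.comp (fderiv ℝ w x)) x := ℓ.hasFDerivAt.comp x hx.hasFDerivAt
      rw [(this.hasLineDerivAt e).lineDeriv, map_smul, smul_eq_mul, mul_comm]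
      rfl
    have e2 : ∫ x, lineDeriv ℝ η x (-e) * (ℓ ∘ w) x = -∫ x, ℓ (fderiv ℝ η x e • w x) := by
      rw [← integral_neg]
      refine integral_congr_ae (Eventually.of_forall fun x => ?_)
      simp only [(hηd x).lineDeriv_eq_fderiv, map_neg, map_smul, smul_eq_mul, Function.comp_apply]
      ring
    rw [← e1, hp, e2, neg_neg]
  refine RCLike.ext ?_ ?_
  · exact key RCLike.reCLM
  · exact key RCLike.imCLM

theorem norm_normed_convolution_le {F : Type*} [NormedAddCommGroup F] [NormedSpace ℝ F]
    (ρ : ContDiffBump (0 : Space N)) {g : Space N → F} {C : ℝ} (hg : ∀ x, ‖g x‖ ≤ C)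
    (x : Space N) :
    ‖(ρ.normed volume ⋆[ContinuousLinearMap.lsmul ℝ ℝ, volume] g) x‖ ≤ C := by
  have h := norm_integral_le_of_norm_le
    (f := fun t => ContinuousLinearMap.lsmul ℝ ℝ (ρ.normed volume t) (g (x - t)))
    (μ := volume) ((ρ.integrable_normed (μ := volume)).mul_const C) (Eventually.of_forall fun t => ?_)
  · rw [integral_mul_const, ρ.integral_normed, one_mul] at h
    exact h
  · simp only [ContinuousLinearMap.lsmul_apply, norm_smul]
    rw [Real.norm_of_nonneg (ρ.nonneg_normed t)]
    have := ρ.nonneg_normed (μ := volume) t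
    gcongr
    exact hg _

/-- Lipschitz functions with compact support in the open set `U` belong to `H¹₀(U)`. -/
theorem memH10_of_lipschitzWith {K : ℝ≥0} {w : Space N → 𝕜} {U : Set (Space N)} (hU : IsOpen U)
    (hw : LipschitzWith K w) (hc : HasCompactSupport w) (hs : tsupport w ⊆ U) :
    MemH10 U w (grad w) := by
  obtain ⟨B, hB⟩ := hw.continuous.bounded_above_of_compact_support hc
  obtain ⟨δ, hδ, hδU⟩ := hc.isCompact.exists_cthickening_subset_open hU hs
  let r : ℕ → ℝ := fun n => 1 / ((n : ℝ) + 1)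
  have hr : ∀ n, 0 < r n := fun n => by positivity
  have hrlim : Tendsto r atTop (𝓝 0) := tendsto_one_div_add_atTop_nhds_zero_nat
  let ρ : ℕ → ContDiffBump (0 : Space N) := fun n =>
    ⟨r n / 2, r n, half_pos (hr n), half_lt_self (hr n)⟩
  let v : ℕ → Space N → 𝕜 := fun n =>
    (ρ n).normed volume ⋆[ContinuousLinearMap.lsmul ℝ ℝ, volume] w
  have hloc : LocallyIntegrable w := hw.continuous.locallyIntegrable
  have hdw : ∀ x, ‖fderiv ℝ w x‖ ≤ K := fun x => norm_fderiv_le_of_lipschitz ℝ hw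
  have hlocd : LocallyIntegrable (fderiv ℝ w) := by
    refine (locallyIntegrable_const (K : ℝ)).mono (measurable_fderiv ℝ w).aestronglyMeasurable ?_
    exact Eventually.of_forall fun x => by simpa using hdw x
  have hvts : ∀ n, tsupport (v n) ⊆ Metric.cthickening (r n) (tsupport w) := by
    intro n
    refine closure_minimal ?_ Metric.isClosed_cthickening
    refine (support_convolution_subset_swap _).trans ?_
    rw [(ρ n).support_normed_eq]
    rintro _ ⟨a, ha, b, hb, rfl⟩
    refine Metric.mem_cthickening_of_dist_le _ a _ _ (subset_tsupport w ha) ?_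
    simpa using (mem_ball_zero_iff.1 hb).le
  have hvc : ∀ n, HasCompactSupport (v n) := fun n =>
    (ρ n).hasCompactSupport_normed.convolution _ hc
  have hvs : ∀ n, ContDiff ℝ (⊤ : ℕ∞) (v n) := fun n =>
    (ρ n).hasCompactSupport_normed.contDiff_convolution_left _ (ρ n).contDiff_normed hloc
  have hgrad : ∀ n x, grad (v n) x = partials 𝕜 N
      (((ρ n).normed volume ⋆[ContinuousLinearMap.lsmul ℝ ℝ, volume] fderiv ℝ w) x) := by
    intro n x
    rw [grad_eq_partials, fderiv_convolution_of_lipschitzWith hw (ρ n).continuous_normed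
      (ρ n).hasCompactSupport_normed]
  set S : Set (Space N) := Metric.cthickening 1 (tsupport w)
  have hSc : IsCompact S := hc.isCompact.cthickening
  have hr1 : ∀ n, r n ≤ 1 := fun n => by
    simp only [r]
    rw [div_le_one (by positivity)]
    simp
  have hvS : ∀ n, ∀ x ∉ S, x ∉ tsupport (v n) := fun n x hx h =>
    hx (Metric.cthickening_mono (hr1 n) _ (hvts n h))
  have hwS : ∀ x ∉ S, x ∉ tsupport w := fun x hx h => hx (Metric.self_subset_cthickening _ h)
  have hSfin : volume.restrict U S ≠ ⊤ :=
    ((Measure.restrict_apply_le _ _).trans_lt hSc.measure_lt_top).ne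
  refine ⟨(hw.continuous.memLp_of_hasCompactSupport hc), memLp_grad hw hc 2 _,
    hasWeakGradient_of_lipschitzWith hw hc, ?_⟩
  -- From `n₀` on the mollification radius is below `δ`, so the supports stay in `U`; the final
  -- sequence is shifted by `n₀`.
  obtain ⟨n₀, hn₀⟩ := eventually_atTop.1 (hrlim.eventually (gt_mem_nhds hδ))
  have hlim1 : Tendsto (fun n => eLpNorm (v n - w) 2 (volume.restrict U)) atTop (𝓝 0) := by
    refine tendsto_eLpNorm_two_of_bounded (C := B) hSc.measurableSet hSfin
      (fun n => (hvs n).continuous.aestronglyMeasurable) hw.continuous.aestronglyMeasurable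
      (fun n => norm_normed_convolution_le _ hB) hB
      (Eventually.of_forall fun n x hx => image_eq_zero_of_notMem_tsupport (hvS n x hx))
      (fun x hx => image_eq_zero_of_notMem_tsupport (hwS x hx)) ?_
    exact Eventually.of_forall fun x =>
      ContDiffBump.convolution_tendsto_right_of_continuous hrlim hw.continuous x
  have hlim2 : Tendsto (fun n => eLpNorm (grad (v n) - grad w) 2 (volume.restrict U)) atTop
      (𝓝 0) := by
    refine tendsto_eLpNorm_two_of_bounded (C := N * K) hSc.measurableSet hSfin
      (fun n => aestronglyMeasurable_grad _ _) (aestronglyMeasurable_grad _ _)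
      (fun n x => ?_) (norm_grad_le_of_lipschitzWith hw)
      (Eventually.of_forall fun n x hx => grad_eq_zero_of_notMem_tsupport (hvS n x hx))
      (fun x hx => grad_eq_zero_of_notMem_tsupport (hwS x hx)) ?_
    · rw [hgrad]
      refine (norm_partials_le _).trans ?_
      gcongr
      exact norm_normed_convolution_le _ hdw x
    -- The differential is merely bounded and measurable, so its mollifications converge almost
    -- everywhere, by Lebesgue differentiation; `K = 2` is the ratio of outer to inner radius of the
    -- bumps.
    · refine ae_restrict_of_ae ?_
      filter_upwards [ContDiffBump.ae_convolution_tendsto_right_of_locallyIntegrable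
        (φ := ρ) (K := 2) hrlim (Eventually.of_forall fun n => by simp [ρ]; linarith) hlocd]
        with x hx
      simp_rw [hgrad]
      exact (continuous_partials.tendsto _).comp hx
  refine ⟨fun n => v (n + n₀), fun n => ⟨hvs _, hvc _, ?_⟩,
    (tendsto_add_atTop_iff_nat n₀).2 hlim1, (tendsto_add_atTop_iff_nat n₀).2 hlim2⟩
  exact (hvts _).trans ((Metric.cthickening_mono (hn₀ _ (by simp)).le _).trans hδU)

end DomainPerturbation

namespace DomainPerturbation

/-! ### Medians and the differentials of Lipschitz functions. -/

/-- The median of `a`, `b` and `0`. -/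
noncomputable def realMedian (a b : ℝ) : ℝ := max (min a b) (min (max a b) 0)

theorem realMedian_self (a : ℝ) : realMedian a a = a := by simp [realMedian]

theorem realMedian_zero_right (a : ℝ) : realMedian a 0 = 0 := by simp [realMedian]

theorem realMedian_zero_left (a : ℝ) : realMedian 0 a = 0 := by simp [realMedian]

theorem abs_realMedian_sub_le (a b a' b' : ℝ) :
    |realMedian a b - realMedian a' b'| ≤ |a - a'| + |b - b'| := by
  have h : max |a - a'| |b - b'| ≤ |a - a'| + |b - b'| :=
    max_le_add_of_nonneg (abs_nonneg _) (abs_nonneg _)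
  refine (abs_max_sub_max_le_max _ _ _ _).trans (max_le ?_ ?_)
  · exact (abs_min_sub_min_le_max _ _ _ _).trans h
  · refine (abs_min_sub_min_le_max _ _ _ _).trans (max_le ?_ (by simp; positivity))
    exact (abs_max_sub_max_le_max _ _ _ _).trans h

variable {𝕜 : Type} [RCLike 𝕜] {N : ℕ}

/-- The median with `0`, taken separately on real and imaginary parts. -/
noncomputable def median (a b : 𝕜) : 𝕜 :=
  (realMedian (RCLike.re a) (RCLike.re b) : 𝕜) +
    (realMedian (RCLike.im a) (RCLike.im b) : 𝕜) * RCLike.I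

theorem median_self (a : 𝕜) : median a a = a := by
  simp [median, realMedian_self, RCLike.re_add_im]

theorem median_zero_right (a : 𝕜) : median a 0 = 0 := by simp [median, realMedian_zero_right]

theorem median_zero_left (a : 𝕜) : median 0 a = 0 := by simp [median, realMedian_zero_left]

/-- The factor `2` adds the contributions of the real and imaginary parts. -/
theorem norm_median_sub_le (a b a' b' : 𝕜) :
    ‖median a b - median a' b'‖ ≤ 2 * (‖a - a'‖ + ‖b - b'‖) := by
  have h : median a b - median a' b' =
      ((realMedian (RCLike.re a) (RCLike.re b) -
        realMedian (RCLike.re a') (RCLike.re b') : ℝ) : 𝕜) +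
      ((realMedian (RCLike.im a) (RCLike.im b) -
        realMedian (RCLike.im a') (RCLike.im b') : ℝ) : 𝕜) * RCLike.I := by
    simp only [median, RCLike.ofReal_sub]
    ring
  rw [h]
  refine (norm_add_le _ _).trans ?_
  rw [norm_mul, RCLike.norm_ofReal, RCLike.norm_ofReal]
  have h1 := abs_realMedian_sub_le (RCLike.re a) (RCLike.re b) (RCLike.re a') (RCLike.re b')
  have h2 := abs_realMedian_sub_le (RCLike.im a) (RCLike.im b) (RCLike.im a') (RCLike.im b')
  rw [← map_sub, ← map_sub] at h1 h2
  have h3 := RCLike.abs_re_le_norm (a - a')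
  have h4 := RCLike.abs_re_le_norm (b - b')
  have h5 := RCLike.abs_im_le_norm (a - a')
  have h6 := RCLike.abs_im_le_norm (b - b')
  have h7 : ‖(RCLike.I : 𝕜)‖ ≤ 1 := by
    rcases RCLike.I_eq_zero_or_im_I_eq_one (K := 𝕜) with h | h
    · simp [h]
    · exact RCLike.norm_I_of_ne_zero (fun h0 => by simp [h0] at h) |>.le
  have h8 := mul_le_of_le_one_right (abs_nonneg (realMedian (RCLike.im a) (RCLike.im b) -
        realMedian (RCLike.im a') (RCLike.im b'))) h7
  linarith

theorem lipschitzWith_median {Ka Kb : ℝ≥0} {a b : Space N → 𝕜} (ha : LipschitzWith Ka a)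
    (hb : LipschitzWith Kb b) : LipschitzWith (2 * (Ka + Kb)) fun x => median (a x) (b x) := by
  refine LipschitzWith.of_dist_le_mul fun x y => ?_
  rw [dist_eq_norm]
  refine (norm_median_sub_le _ _ _ _).trans ?_
  have h1 := ha.norm_sub_le x y
  have h2 := hb.norm_sub_le x y
  rw [dist_eq_norm]
  push_cast
  linarith

/-- The bound comes from the increments of the median at `x`, so the median itself need not be
differentiable there: the default value `0` also obeys it. -/
theorem norm_fderiv_median_le {a b : Space N → 𝕜} {x : Space N} (ha : DifferentiableAt ℝ a x)
    (hb : DifferentiableAt ℝ b x) :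
    ‖fderiv ℝ (fun y => median (a y) (b y)) x‖ ≤ 2 * (‖fderiv ℝ a x‖ + ‖fderiv ℝ b x‖) := by
  refine le_of_forall_pos_le_add fun ε hε => ?_
  have hbound : ∀ {g : Space N → 𝕜}, DifferentiableAt ℝ g x →
      ∀ᶠ y in 𝓝 x, ‖g y - g x‖ ≤ (‖fderiv ℝ g x‖ + ε / 4) * ‖y - x‖ := by
    intro g hg
    filter_upwards [hg.hasFDerivAt.isLittleO.def (c := ε / 4) (by positivity)] with y hy
    calc ‖g y - g x‖ = ‖(g y - g x - fderiv ℝ g x (y - x)) + fderiv ℝ g x (y - x)‖ := by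
          rw [sub_add_cancel]
      _ ≤ ε / 4 * ‖y - x‖ + ‖fderiv ℝ g x‖ * ‖y - x‖ :=
          (norm_add_le _ _).trans (add_le_add hy (ContinuousLinearMap.le_opNorm _ _))
      _ = _ := by ring
  refine norm_fderiv_le_of_lip' ℝ (by positivity) ?_
  filter_upwards [hbound ha, hbound hb] with y h1 h2
  refine (norm_median_sub_le _ _ _ _).trans ?_
  linarith

/-- The differential of a Lipschitz function vanishes almost everywhere on its zero set. -/
theorem ae_fderiv_eq_zero_of_eq_zero {K : ℝ≥0} {g : Space N → 𝕜} (hg : LipschitzWith K g) :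
    ∀ᵐ x, g x = 0 → fderiv ℝ g x = 0 := by
  have hn : LipschitzWith (1 * K) fun x => ‖g x‖ := lipschitzWith_one_norm.comp hg
  filter_upwards [hn.ae_differentiableAt (μ := (volume : Measure (Space N)))] with x hx hgx
  -- A zero of `g` is a minimum of `‖g‖`; where `‖g‖` is differentiable its differential vanishes
  -- there, so `g` itself is `o(‖y - x‖)`.
  have hmin : IsLocalMin (fun x => ‖g x‖) x := Eventually.of_forall fun y => by simp [hgx]
  have h0 : HasFDerivAt (fun x => ‖g x‖) (0 : Space N →L[ℝ] ℝ) x :=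
    hmin.fderiv_eq_zero ▸ hx.hasFDerivAt
  refine HasFDerivAt.fderiv (HasFDerivAt.of_isLittleO ?_)
  have := h0.isLittleO
  simp only [hgx, norm_zero, sub_zero, zero_apply] at this ⊢
  exact this.of_norm_left

/-- A function which is Lipschitz on an open set and vanishes outside a compact subset of it is
Lipschitz. -/
theorem exists_lipschitzWith_of_lipschitzOnWith {F : Type*} [NormedAddCommGroup F] {K : ℝ≥0}
    {b : Space N → F} {U S : Set (Space N)} (hU : IsOpen U) (hb : LipschitzOnWith K b U)
    (hS : IsCompact S) (hSU : S ⊆ U) (hzero : ∀ x ∉ S, b x = 0) :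
    ∃ L : ℝ≥0, LipschitzWith L b := by
  obtain ⟨δ, hδ, hδU⟩ := hS.exists_cthickening_subset_open hU hSU
  obtain ⟨B, hB⟩ := hS.exists_bound_of_continuousOn (hb.continuousOn.mono hSU)
  have hB0 : ∀ x, ‖b x‖ ≤ max B 0 := fun x => by
    by_cases hx : x ∈ S
    · exact (hB x hx).trans (le_max_left _ _)
    · simp [hzero x hx]
  -- Points outside `U` are at distance at least `δ` from `S`, so the sup bound acts as a Lipschitz
  -- bound.
  have hout : ∀ x y, y ∉ U → ‖b x‖ ≤ max B 0 / δ * dist x y := by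
    intro x y hy
    by_cases hx : x ∈ S
    · have hd : δ ≤ dist x y := by
        by_contra! h
        exact hy (hδU (Metric.mem_cthickening_of_dist_le y x δ S hx (by rw [dist_comm]; exact h.le)))
      calc ‖b x‖ ≤ max B 0 := hB0 x
        _ = max B 0 / δ * δ := by field_simp
        _ ≤ _ := by gcongr
    · rw [hzero x hx, norm_zero]
      positivity
  refine ⟨K + (max B 0 / δ).toNNReal, LipschitzWith.of_dist_le_mul fun x y => ?_⟩
  rw [NNReal.coe_add, Real.coe_toNNReal _ (by positivity), add_mul]
  have h1 : 0 ≤ (K : ℝ) * dist x y := by positivity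
  have h2 : 0 ≤ max B 0 / δ * dist x y := by positivity
  by_cases hy : y ∈ U
  · by_cases hx : x ∈ U
    · linarith [hb.dist_le_mul x hx y hy]
    · have := hout y x hx
      rw [hzero x fun h => hx (hSU h), dist_zero_left]
      rw [dist_comm] at this
      linarith
  · have := hout x y hy
    rw [hzero y fun h => hy (hSU h), dist_zero_right]
    linarith

/-! ### Truncating a test function to the common domain. -/

namespace IsTestFunction

theorem exists_lipschitzWith {Ω : Set (Space N)} {v : Space N → 𝕜} (hv : IsTestFunction Ω v) :
    ∃ K : ℝ≥0, LipschitzWith K v :=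
  hv.contDiff.lipschitzWith_of_hasCompactSupport hv.hasCompactSupport (by simp)

theorem continuous_grad {Ω : Set (Space N)} {v : Space N → 𝕜} (hv : IsTestFunction Ω v) :
    Continuous (grad v) :=
  continuous_partials.comp (hv.contDiff.continuous_fderiv (by simp))

end IsTestFunction

namespace IsLipschitzPair

variable {φ ψ : Space N → Space N} {Ω Ω' : Set (Space N)} {M : ℝ} {v : Space N → 𝕜}

theorem tsupport_pullback_subset (h : IsLipschitzPair φ ψ Ω Ω' M) (hv : IsTestFunction Ω v) :
    tsupport (Ω'.indicator (v ∘ ψ)) ⊆ φ '' tsupport v ∧ IsCompact (φ '' tsupport v) ∧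
      φ '' tsupport v ⊆ Ω' := by
  obtain ⟨K, hK⟩ := h.lipschitz
  have hc : IsCompact (φ '' tsupport v) :=
    hv.hasCompactSupport.isCompact.image_of_continuousOn (hK.continuousOn.mono hv.tsupport_subset)
  refine ⟨closure_minimal ?_ hc.isClosed, hc, ?_⟩
  · intro y hy
    have hyΩ : y ∈ Ω' := Set.mem_of_indicator_ne_zero hy
    rw [Function.mem_support, Set.indicator_of_mem hyΩ] at hy
    exact ⟨ψ y, subset_tsupport v hy, h.rightInvOn hyΩ⟩
  · rintro _ ⟨x, hx, rfl⟩
    exact h.mapsTo (hv.tsupport_subset hx)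

/-- `ψ` is controlled on `Ω'` only; compactness of the support inside `Ω'` makes the zero extension
globally Lipschitz. -/
theorem exists_lipschitzWith_pullback (h : IsLipschitzPair φ ψ Ω Ω' M)
    (hv : IsTestFunction Ω v) : ∃ K : ℝ≥0, LipschitzWith K (Ω'.indicator (v ∘ ψ)) := by
  obtain ⟨h1, h2, h3⟩ := h.tsupport_pullback_subset hv
  obtain ⟨K, hK⟩ := h.lipschitz_symm
  obtain ⟨K', hK'⟩ := hv.exists_lipschitzWith
  refine exists_lipschitzWith_of_lipschitzOnWith h.isOpen_target (K := K' * K) ?_ h2 h3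
    fun x hx => image_eq_zero_of_notMem_tsupport fun hx' => hx (h1 hx')
  intro x hx y hy
  rw [Set.indicator_of_mem hx, Set.indicator_of_mem hy]
  exact (hK'.comp_lipschitzOnWith hK) hx hy

theorem ae_norm_fderiv_pullback_le (h : IsLipschitzPair φ ψ Ω Ω' M) (hv : IsTestFunction Ω v) :
    ∀ᵐ y, ‖fderiv ℝ (Ω'.indicator (v ∘ ψ)) y‖ ≤
      Ω'.indicator (fun y => ‖fderiv ℝ v (ψ y)‖ * M) y := by
  obtain ⟨K, hK⟩ := h.lipschitz_symm
  have h1 := (ae_differentiableAt_of_lipschitzOnWith h.isOpen_target hK).and h.norm_fderiv_symm_le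
  rw [ae_restrict_iff' h.isOpen_target.measurableSet] at h1
  filter_upwards [h1] with y hy
  by_cases hyΩ : y ∈ Ω'
  · obtain ⟨hd, hM⟩ := hy hyΩ
    have heq : Ω'.indicator (v ∘ ψ) =ᶠ[𝓝 y] v ∘ ψ := by
      filter_upwards [h.isOpen_target.mem_nhds hyΩ] with z hz using Set.indicator_of_mem hz _
    rw [heq.fderiv_eq, Set.indicator_of_mem hyΩ,
      fderiv_comp y (hv.contDiff.differentiable (by simp) _) hd]
    exact (ContinuousLinearMap.opNorm_comp_le _ _).trans (by gcongr)
  · obtain ⟨h1, _, h3⟩ := h.tsupport_pullback_subset hv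
    rw [fderiv_of_notMem_tsupport _ fun hy => hyΩ (h3 (h1 hy)), Set.indicator_of_notMem hyΩ,
      norm_zero]

theorem eLpNorm_comp_le (h : IsLipschitzPair φ ψ Ω Ω' M) (g : Space N → Vec 𝕜 N)
    {s : Set (Space N)} (hsm : MeasurableSet s) (hs : s ⊆ Ω) :
    eLpNorm (g ∘ ψ) 2 (volume.restrict (φ '' s)) ≤
      ENNReal.ofReal (M ^ N) ^ (1 / 2 : ℝ) * eLpNorm g 2 (volume.restrict s) := by
  rw [eLpNorm_two_eq, eLpNorm_two_eq, ← ENNReal.mul_rpow_of_nonneg _ _ (by norm_num)]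
  gcongr
  refine (h.lintegral_image_le hsm hs _).trans (mul_le_mul_right (le_of_eq ?_) _)
  refine setLIntegral_congr_fun hsm fun x hx => ?_
  simp [h.leftInvOn (hs hx)]

/-- The constant in the comparison of a test function with its truncation. -/
noncomputable def truncationConst (N : ℕ) (M : ℝ) : ℝ≥0∞ :=
  ENNReal.ofReal (3 * N ^ 2) +
    ENNReal.ofReal (2 * N ^ 2 * M) * ENNReal.ofReal (M ^ N) ^ (1 / 2 : ℝ)

theorem truncationConst_ne_top (N : ℕ) (M : ℝ) : truncationConst N M ≠ ⊤ := by
  unfold truncationConst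
  finiteness

/-- The median of a test function `v` on `Ω`, of its transplantation to `Ω'`, and of `0`. -/
noncomputable def truncation (ψ : Space N → Space N) (Ω' : Set (Space N)) (v : Space N → 𝕜) :
    Space N → 𝕜 :=
  fun x => median (v x) (Ω'.indicator (v ∘ ψ) x)

theorem exists_lipschitzWith_truncation (h : IsLipschitzPair φ ψ Ω Ω' M)
    (hv : IsTestFunction Ω v) : ∃ K : ℝ≥0, LipschitzWith K (truncation ψ Ω' v) := by
  obtain ⟨Kb, hKb⟩ := h.exists_lipschitzWith_pullback hv
  obtain ⟨Kv, hKv⟩ := hv.exists_lipschitzWith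
  exact ⟨_, lipschitzWith_median hKv hKb⟩

theorem hasCompactSupport_truncation (hv : IsTestFunction Ω v) :
    HasCompactSupport (truncation ψ Ω' v) :=
  hv.hasCompactSupport.mono fun x hx h0 => hx (by simp only [truncation, h0, median_zero_left])

/-- Having `0` as third entry makes the median vanish as soon as one of the other two does. -/
theorem tsupport_truncation_subset (h : IsLipschitzPair φ ψ Ω Ω' M) (hv : IsTestFunction Ω v) :
    tsupport (truncation ψ Ω' v) ⊆ Ω ∩ Ω' := by
  obtain ⟨hb1, _, hb3⟩ := h.tsupport_pullback_subset hv
  have h1 : Function.support (truncation ψ Ω' v) ⊆ Function.support v := fun x hx h0 =>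
    hx (by simp only [truncation, h0, median_zero_left])
  have h2 : Function.support (truncation ψ Ω' v) ⊆ Function.support (Ω'.indicator (v ∘ ψ)) :=
    fun x hx h0 => hx (by simp only [truncation, h0, median_zero_right])
  exact Set.subset_inter ((closure_mono h1).trans hv.tsupport_subset)
    ((closure_mono h2).trans (hb1.trans hb3))

/-- At a fixed point in `Ω` both entries of the median are `v x`; outside `Ω`, `v x` is zero. -/
theorem sub_truncation_eq_zero (h : IsLipschitzPair φ ψ Ω Ω' M) (hv : IsTestFunction Ω v)
    {x : Space N} (hx : x ∉ {x ∈ Ω | φ x ≠ x}) : v x - truncation ψ Ω' v x = 0 := by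
  by_cases hxΩ : x ∈ Ω
  · have hfix : φ x = x := by
      by_contra hne
      exact hx ⟨hxΩ, hne⟩
    have hxΩ' : x ∈ Ω' := hfix ▸ h.mapsTo hxΩ
    have hψ : ψ x = x := by
      conv_lhs => rw [← hfix]
      exact h.leftInvOn hxΩ
    simp [truncation, Set.indicator_of_mem hxΩ', hψ, median_self]
  · have h0 : v x = 0 := image_eq_zero_of_notMem_tsupport fun h => hxΩ (hv.tsupport_subset h)
    simp [truncation, h0, median_zero_left]

/-- A point of `Ω'` moved by `φ` is moved by `ψ` too, hence lies in the image of the moved set. The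
gradient of `v` is thus sampled only at moved points. -/
theorem ae_norm_fderiv_pullback_le_grad (h : IsLipschitzPair φ ψ Ω Ω' M) (hM : 0 < M)
    (hv : IsTestFunction Ω v) :
    ∀ᵐ x, x ∈ {x ∈ Ω | φ x ≠ x} → ‖fderiv ℝ (Ω'.indicator (v ∘ ψ)) x‖ ≤
      (φ '' {x ∈ Ω | φ x ≠ x}).indicator (fun x => N * M * ‖(grad v ∘ ψ) x‖) x := by
  filter_upwards [h.ae_norm_fderiv_pullback_le hv] with x hxb hxE
  refine hxb.trans ?_
  by_cases hxΩ' : x ∈ Ω'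
  · have hxE' : x ∈ φ '' {x ∈ Ω | φ x ≠ x} := by
      rw [h.image_moved]
      refine ⟨hxΩ', fun hfix => hxE.2 ?_⟩
      conv_lhs => rw [← hfix]
      exact h.rightInvOn hxΩ'
    rw [Set.indicator_of_mem hxΩ', Set.indicator_of_mem hxE']
    calc ‖fderiv ℝ v (ψ x)‖ * M ≤ (N * ‖grad v (ψ x)‖) * M := by
          gcongr
          exact norm_fderiv_le_grad _ _
      _ = _ := by simp only [Function.comp_apply]; ring
  · rw [Set.indicator_of_notMem hxΩ']
    exact Set.indicator_nonneg (fun y _ => by positivity) x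

theorem ae_norm_grad_sub_truncation_le (h : IsLipschitzPair φ ψ Ω Ω' M) (hM : 0 < M)
    (hv : IsTestFunction Ω v) :
    ∀ᵐ x, ‖(grad v - grad (truncation ψ Ω' v)) x‖ ≤
      {x ∈ Ω | φ x ≠ x}.indicator (fun x => 3 * (N : ℝ) ^ 2 * ‖grad v x‖) x +
        2 * N * (φ '' {x ∈ Ω | φ x ≠ x}).indicator (fun x => N * M * ‖(grad v ∘ ψ) x‖) x := by
  obtain ⟨Kb, hKb⟩ := h.exists_lipschitzWith_pullback hv
  obtain ⟨Kv, hKv⟩ := hv.exists_lipschitzWith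
  obtain ⟨Kw, hw⟩ := h.exists_lipschitzWith_truncation hv
  have hvd : Differentiable ℝ v := hv.contDiff.differentiable (by simp)
  filter_upwards [ae_fderiv_eq_zero_of_eq_zero (hKv.sub hw),
    hw.ae_differentiableAt (μ := (volume : Measure (Space N))),
    hKb.ae_differentiableAt (μ := (volume : Measure (Space N))),
    h.ae_norm_fderiv_pullback_le_grad hM hv] with x hx0 hdw hdb hxb
  have hfd : fderiv ℝ (fun x => v x - truncation ψ Ω' v x) x =
      fderiv ℝ v x - fderiv ℝ (truncation ψ Ω' v) x := fderiv_sub (hvd x) hdw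
  have hgr : (grad v - grad (truncation ψ Ω' v)) x =
      partials 𝕜 N (fderiv ℝ v x - fderiv ℝ (truncation ψ Ω' v) x) := by
    rw [map_sub]; rfl
  have hI2 : 0 ≤ (φ '' {x ∈ Ω | φ x ≠ x}).indicator (fun x => N * M * ‖(grad v ∘ ψ) x‖) x :=
    Set.indicator_nonneg (fun y _ => by positivity) x
  rw [hgr]
  by_cases hxE : x ∈ {x ∈ Ω | φ x ≠ x}
  · rw [Set.indicator_of_mem hxE]
    -- Adding the differential of `v` itself gives the `3`; each passage between differential and
    -- gradient costs a factor `N`.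
    have hmed : ‖fderiv ℝ (truncation ψ Ω' v) x‖ ≤
        2 * (‖fderiv ℝ v x‖ + ‖fderiv ℝ (Ω'.indicator (v ∘ ψ)) x‖) :=
      norm_fderiv_median_le (hvd x) hdb
    have hv1 := norm_fderiv_le_grad v x
    calc ‖partials 𝕜 N (fderiv ℝ v x - fderiv ℝ (truncation ψ Ω' v) x)‖
        ≤ N * (‖fderiv ℝ v x‖ + ‖fderiv ℝ (truncation ψ Ω' v) x‖) :=
          (norm_partials_le _).trans (by gcongr; exact norm_sub_le _ _)
      _ ≤ N * (3 * (N * ‖grad v x‖) + 2 * (φ '' {x ∈ Ω | φ x ≠ x}).indicator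
            (fun x => N * M * ‖(grad v ∘ ψ) x‖) x) := by
          refine mul_le_mul_of_nonneg_left ?_ (Nat.cast_nonneg N)
          linarith [hxb hxE]
      _ = _ := by ring
  -- Off the moved set the difference is zero, so almost everywhere its differential is too.
  · rw [← hfd, hx0 (h.sub_truncation_eq_zero hv hxE), map_zero, norm_zero,
      Set.indicator_of_notMem hxE, zero_add]
    positivity

theorem eLpNorm_indicator_const_mul_norm (p : ℝ≥0∞) {c : ℝ} (hc : 0 ≤ c) (g : Space N → Vec 𝕜 N)
    {s : Set (Space N)} (hs : MeasurableSet s) :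
    eLpNorm (s.indicator fun x => c * ‖g x‖) p volume =
      ENNReal.ofReal c * eLpNorm g p (volume.restrict s) := by
  rw [eLpNorm_indicator_eq_eLpNorm_restrict hs, ← eLpNorm_norm g,
    ← Real.enorm_of_nonneg hc, ← eLpNorm_const_smul]
  rfl

/-- A test function on `Ω` is close to its truncation, up to the gradient on the set of points
moved by `φ`. -/
theorem eLpNorm_grad_sub_truncation_le (h : IsLipschitzPair φ ψ Ω Ω' M) (hM : 0 < M)
    (hv : IsTestFunction Ω v) :
    eLpNorm (grad v - grad (truncation ψ Ω' v)) 2 volume ≤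
      truncationConst N M * eLpNorm (grad v) 2 (volume.restrict {x ∈ Ω | φ x ≠ x}) := by
  have hpt := h.ae_norm_grad_sub_truncation_le hM hv
  have hEm : MeasurableSet {x ∈ Ω | φ x ≠ x} := h.isOpen_moved.measurableSet
  have hEΩ : {x ∈ Ω | φ x ≠ x} ⊆ Ω := Set.sep_subset _ _
  have hE'm : MeasurableSet (φ '' {x ∈ Ω | φ x ≠ x}) := by
    rw [h.image_moved]; exact h.symm.isOpen_moved.measurableSet
  have hE'Ω : φ '' {x ∈ Ω | φ x ≠ x} ⊆ Ω' := by
    rw [h.image_moved]; exact Set.sep_subset _ _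
  generalize {x ∈ Ω | φ x ≠ x} = E at *
  obtain ⟨Kψ, hKψ⟩ := h.lipschitz_symm
  have hcont : ContinuousOn (grad v ∘ ψ) (φ '' E) :=
    hv.continuous_grad.comp_continuousOn (hKψ.continuousOn.mono hE'Ω)
  have hm1 : AEStronglyMeasurable (E.indicator fun x => 3 * (N : ℝ) ^ 2 * ‖grad v x‖) volume :=
    ((hv.continuous_grad.norm.const_mul _).aestronglyMeasurable).indicator hEm
  have hm2 : AEStronglyMeasurable
      ((φ '' E).indicator fun x => 2 * N * (N * M) * ‖(grad v ∘ ψ) x‖) volume := by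
    rw [aestronglyMeasurable_indicator_iff hE'm]
    exact (continuousOn_const.mul hcont.norm).aestronglyMeasurable hE'm
  calc eLpNorm (grad v - grad (truncation ψ Ω' v)) 2 volume
      ≤ eLpNorm ((E.indicator fun x => 3 * (N : ℝ) ^ 2 * ‖grad v x‖) +
        (φ '' E).indicator fun x => 2 * N * (N * M) * ‖(grad v ∘ ψ) x‖) 2 volume := by
        refine eLpNorm_mono_ae ?_
        filter_upwards [hpt] with x hx
        refine (hx.trans (le_of_eq ?_)).trans (le_abs_self _)
        by_cases hxE : x ∈ φ '' E <;> simp [Set.indicator, hxE, mul_assoc]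
    _ ≤ _ := eLpNorm_add_le hm1 hm2 (by norm_num)
    _ = ENNReal.ofReal (3 * N ^ 2) * eLpNorm (grad v) 2 (volume.restrict E) +
        ENNReal.ofReal (2 * N * (N * M)) *
          eLpNorm (grad v ∘ ψ) 2 (volume.restrict (φ '' E)) := by
        rw [eLpNorm_indicator_const_mul_norm _ (by positivity) _ hEm,
          eLpNorm_indicator_const_mul_norm _ (by positivity) _ hE'm]
    _ ≤ ENNReal.ofReal (3 * N ^ 2) * eLpNorm (grad v) 2 (volume.restrict E) +
        ENNReal.ofReal (2 * N * (N * M)) * (ENNReal.ofReal (M ^ N) ^ (1 / 2 : ℝ) *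
          eLpNorm (grad v) 2 (volume.restrict E)) := by
        gcongr
        exact h.eLpNorm_comp_le _ hEm hEΩ
    _ = _ := by
        rw [truncationConst, show 2 * (N : ℝ) * (N * M) = 2 * N ^ 2 * M by ring]
        ring

end IsLipschitzPair

end DomainPerturbation

namespace DomainPerturbation

/-! ### The energy form and Céa's lemma. -/

variable {𝕜 : Type} [RCLike 𝕜] {N : ℕ}

/-- The sesquilinear form with real matrix `B`. -/
def sesqForm (B : Matrix (Fin N) (Fin N) ℝ) (X Y : Vec 𝕜 N) : 𝕜 :=
  ∑ i, ∑ j, (B i j : 𝕜) * X i * (starRingEnd 𝕜) (Y j)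

theorem sesqForm_sub_left (B : Matrix (Fin N) (Fin N) ℝ) (X X' Y : Vec 𝕜 N) :
    sesqForm B (X - X') Y = sesqForm B X Y - sesqForm B X' Y := by
  simp [sesqForm, mul_sub, sub_mul, Finset.sum_sub_distrib]

theorem sesqForm_sub_right (B : Matrix (Fin N) (Fin N) ℝ) (X Y Y' : Vec 𝕜 N) :
    sesqForm B X (Y - Y') = sesqForm B X Y - sesqForm B X Y' := by
  simp [sesqForm, mul_sub, Finset.sum_sub_distrib]

theorem sesqForm_zero_left (B : Matrix (Fin N) (Fin N) ℝ) (Y : Vec 𝕜 N) :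
    sesqForm B 0 Y = 0 := by simp [sesqForm]

theorem sum_single_add_single (B : Matrix (Fin N) (Fin N) ℝ) (i j : Fin N) (s : ℝ) :
    ∑ k, ∑ l, B k l * (EuclideanSpace.single i 1 + EuclideanSpace.single j s : Space N) k *
      (EuclideanSpace.single i 1 + EuclideanSpace.single j s : Space N) l =
      B i i + s * B i j + s * B j i + s ^ 2 * B j j := by
  simp only [PiLp.add_apply, PiLp.single_apply, mul_add, add_mul, mul_ite, ite_mul, mul_one,
    mul_zero, zero_mul, Finset.sum_add_distrib, Finset.sum_ite_eq', Finset.mem_univ, if_true]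
  ring

/-- The ellipticity bounds for a single symmetric matrix. -/
structure IsEllipticMatrix (B : Matrix (Fin N) (Fin N) ℝ) (M : ℝ) : Prop where
  symm : B.IsSymm
  lower : ∀ ξ : Space N, 1 / M * ‖ξ‖ ^ 2 ≤ ∑ i, ∑ j, B i j * ξ i * ξ j
  upper : ∀ ξ : Space N, ∑ i, ∑ j, B i j * ξ i * ξ j ≤ M * ‖ξ‖ ^ 2

namespace IsEllipticMatrix

variable {B : Matrix (Fin N) (Fin N) ℝ} {M : ℝ}

/-- The diagonal is bounded by testing on basis vectors; positivity at `e_i ± e_j` and symmetry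
bound `2|B_ij|` by `B_ii + B_jj`. -/
theorem abs_entry_le (hB : IsEllipticMatrix B M) (hM : 0 < M) (i j : Fin N) : |B i j| ≤ M := by
  have hpos : ∀ s, 0 ≤ B i i + s * B i j + s * B j i + s ^ 2 * B j j := fun s => by
    rw [← sum_single_add_single]
    exact le_trans (by positivity) (hB.lower _)
  have hdiag : ∀ k, B k k ≤ M := fun k => by
    have h1 := hB.upper (EuclideanSpace.single k 1 + EuclideanSpace.single k 0)
    have h0 : (EuclideanSpace.single k (0 : ℝ) : Space N) = 0 := by
      ext l
      simp
    rw [sum_single_add_single, h0] at h1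
    simpa using h1
  have hs := hB.symm.apply i j
  have h1 := hpos 1
  have h2 := hpos (-1)
  rw [abs_le]
  constructor <;> linarith [hdiag i, hdiag j]

theorem norm_sesqForm_le (hB : IsEllipticMatrix B M) (hM : 0 < M) (X Y : Vec 𝕜 N) :
    ‖sesqForm B X Y‖ ≤ N ^ 2 * M * (‖X‖ * ‖Y‖) := by
  calc ‖sesqForm B X Y‖ ≤ ∑ _i : Fin N, ∑ _j : Fin N, M * (‖X‖ * ‖Y‖) := by
        refine norm_sum_le_of_le _ fun i _ => norm_sum_le_of_le _ fun j _ => ?_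
        rw [norm_mul, norm_mul, RCLike.norm_ofReal, RCLike.norm_conj, mul_assoc]
        gcongr
        · exact hB.abs_entry_le hM i j
        · exact PiLp.norm_apply_le _ _
        · exact PiLp.norm_apply_le _ _
    _ = _ := by simp; ring

/-- In the real part of `X_i conj(X_j)` only products of two real or of two imaginary parts survive,
so the real bound applies to each. -/
theorem le_re_sesqForm_self (hB : IsEllipticMatrix B M) (X : Vec 𝕜 N) :
    1 / M * ‖X‖ ^ 2 ≤ RCLike.re (sesqForm B X X) := by
  let a : Space N := WithLp.toLp 2 fun i => RCLike.re (X i)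
  let b : Space N := WithLp.toLp 2 fun i => RCLike.im (X i)
  have h1 : ‖X‖ ^ 2 = ‖a‖ ^ 2 + ‖b‖ ^ 2 := by
    simp only [EuclideanSpace.norm_sq_eq, ← Finset.sum_add_distrib]
    refine Finset.sum_congr rfl fun i _ => ?_
    rw [← RCLike.normSq_eq_def', RCLike.normSq_apply]
    simp [a, b]
    ring
  have h2 : RCLike.re (sesqForm B X X) =
      (∑ i, ∑ j, B i j * a i * a j) + ∑ i, ∑ j, B i j * b i * b j := by
    simp only [sesqForm, map_sum, ← Finset.sum_add_distrib]
    refine Finset.sum_congr rfl fun i _ => Finset.sum_congr rfl fun j _ => ?_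
    rw [mul_assoc, RCLike.re_ofReal_mul, RCLike.mul_re]
    simp [a, b]
    ring
  rw [h1, h2, mul_add]
  exact add_le_add (hB.lower a) (hB.lower b)

end IsEllipticMatrix

section Energy

variable {α : Type*} [MeasurableSpace α] {μ : Measure α} {A : α → Matrix (Fin N) (Fin N) ℝ}
  {M : ℝ}

theorem integrable_sesqForm (hM : 0 < M) (hAm : ∀ i j, AEMeasurable (fun x => A x i j) μ)
    (hA : ∀ᵐ x ∂μ, IsEllipticMatrix (A x) M) {X Y : α → Vec 𝕜 N} (hX : MemLp X 2 μ)
    (hY : MemLp Y 2 μ) : Integrable (fun x => sesqForm (A x) (X x) (Y x)) μ := by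
  have hXY : Integrable (fun x => N ^ 2 * M * (‖X x‖ * ‖Y x‖)) μ :=
    (hX.norm.integrable_mul hY.norm).const_mul _
  refine hXY.mono' ?_ (hA.mono fun x hx => hx.norm_sesqForm_le hM _ _)
  have hproj : ∀ i, Continuous fun X : Vec 𝕜 N => X i := fun i =>
    (EuclideanSpace.proj i : Vec 𝕜 N →L[𝕜] 𝕜).continuous
  refine Finset.aestronglyMeasurable_fun_sum _ fun i _ =>
    Finset.aestronglyMeasurable_fun_sum _ fun j _ => ?_
  exact ((RCLike.continuous_ofReal.comp_aestronglyMeasurable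
    (hAm i j).aestronglyMeasurable).mul ((hproj i).comp_aestronglyMeasurable hX.1)).mul
    (RCLike.continuous_conj.comp_aestronglyMeasurable ((hproj j).comp_aestronglyMeasurable hY.1))

theorem lintegral_enorm_sq_eq {X : α → Vec 𝕜 N} (hX : MemLp X 2 μ) :
    ∫⁻ x, ‖X x‖ₑ ^ 2 ∂μ = ENNReal.ofReal (∫ x, ‖X x‖ ^ 2 ∂μ) := by
  rw [ofReal_integral_eq_lintegral_ofReal hX.norm.integrable_sq
    (Eventually.of_forall fun x => by positivity)]
  refine lintegral_congr fun x => ?_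
  rw [← ofReal_norm, ENNReal.ofReal_pow (norm_nonneg _)]

/-- Céa's lemma: a vector field `T` is bounded by its distance to any field `G` to which it is
orthogonal with respect to the energy. -/
theorem eLpNorm_le_of_integral_sesqForm_eq_zero (hM : 0 < M)
    (hAm : ∀ i j, AEMeasurable (fun x => A x i j) μ)
    (hA : ∀ᵐ x ∂μ, IsEllipticMatrix (A x) M) {T G : α → Vec 𝕜 N} (hT : MemLp T 2 μ)
    (hG : MemLp G 2 μ) (horth : ∫ x, sesqForm (A x) (T x) (G x) ∂μ = 0) :
    eLpNorm T 2 μ ≤ ENNReal.ofReal (N ^ 2 * M ^ 2) * eLpNorm (T - G) 2 μ := by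
  have hTG : MemLp (T - G) 2 μ := hT.sub hG
  have hi1 := integrable_sesqForm hM hAm hA hT hT
  have hi2 := integrable_sesqForm hM hAm hA hT hG
  have hiT := hT.norm.integrable_sq
  have hiTG := hTG.norm.integrable_sq
  have h1 : ∫ x, sesqForm (A x) (T x) ((T - G) x) ∂μ = ∫ x, sesqForm (A x) (T x) (T x) ∂μ := by
    simp only [Pi.sub_apply, sesqForm_sub_right]
    rw [integral_sub hi1 hi2, horth, sub_zero]
  have h2 : 1 / M * ∫ x, ‖T x‖ ^ 2 ∂μ ≤ RCLike.re (∫ x, sesqForm (A x) (T x) (T x) ∂μ) := by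
    rw [← integral_re hi1, ← integral_const_mul]
    exact integral_mono_ae (hiT.const_mul _) hi1.re (hA.mono fun x hx => hx.le_re_sesqForm_self _)
  -- Young's inequality, weighted so that the `T` term uses up exactly half of the coercivity
  -- constant `1 / M`.
  have h3 : ‖∫ x, sesqForm (A x) (T x) ((T - G) x) ∂μ‖ ≤
      ∫ x, (1 / (2 * M) * ‖T x‖ ^ 2 + N ^ 4 * M ^ 3 / 2 * ‖(T - G) x‖ ^ 2) ∂μ := by
    refine norm_integral_le_of_norm_le ((hiT.const_mul _).add (hiTG.const_mul _)) ?_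
    filter_upwards [hA] with x hx
    refine (hx.norm_sesqForm_le hM _ _).trans ?_
    have hsq := mul_nonneg (one_div_pos.2 (mul_pos two_pos hM)).le
      (sq_nonneg (‖T x‖ - N ^ 2 * M ^ 2 * ‖(T - G) x‖))
    have hexp : 1 / (2 * M) * (‖T x‖ - N ^ 2 * M ^ 2 * ‖(T - G) x‖) ^ 2 =
        1 / (2 * M) * ‖T x‖ ^ 2 + N ^ 4 * M ^ 3 / 2 * ‖(T - G) x‖ ^ 2 -
          N ^ 2 * M * (‖T x‖ * ‖(T - G) x‖) := by
      field_simp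
      ring
    linarith
  rw [integral_add (hiT.const_mul _) (hiTG.const_mul _), integral_const_mul,
    integral_const_mul, h1] at h3
  have h4 := (h2.trans (RCLike.re_le_norm _)).trans h3
  have h5 : ∫ x, ‖T x‖ ^ 2 ∂μ ≤ (N ^ 2 * M ^ 2) ^ 2 * ∫ x, ‖(T - G) x‖ ^ 2 ∂μ := by
    have h6 : 1 / (2 * M) * ∫ x, ‖T x‖ ^ 2 ∂μ ≤
        N ^ 4 * M ^ 3 / 2 * ∫ x, ‖(T - G) x‖ ^ 2 ∂μ := by
      have : 1 / M * ∫ x, ‖T x‖ ^ 2 ∂μ =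
          1 / (2 * M) * (∫ x, ‖T x‖ ^ 2 ∂μ) + 1 / (2 * M) * ∫ x, ‖T x‖ ^ 2 ∂μ := by
        field_simp
        ring
      linarith
    have h7 := mul_le_mul_of_nonneg_left h6 (mul_pos two_pos hM).le
    calc ∫ x, ‖T x‖ ^ 2 ∂μ = 2 * M * (1 / (2 * M) * ∫ x, ‖T x‖ ^ 2 ∂μ) := by field_simp
      _ ≤ _ := h7
      _ = _ := by ring
  rw [eLpNorm_two_eq, eLpNorm_two_eq, lintegral_enorm_sq_eq hT, lintegral_enorm_sq_eq hTG]
  calc ENNReal.ofReal (∫ x, ‖T x‖ ^ 2 ∂μ) ^ (1 / 2 : ℝ)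
      ≤ ENNReal.ofReal ((N ^ 2 * M ^ 2) ^ 2 * ∫ x, ‖(T - G) x‖ ^ 2 ∂μ) ^ (1 / 2 : ℝ) := by
        gcongr
    _ = _ := by
        rw [ENNReal.ofReal_mul (by positivity), ENNReal.mul_rpow_of_nonneg _ _ (by norm_num),
          ENNReal.ofReal_pow (by positivity), ← ENNReal.rpow_natCast, ← ENNReal.rpow_mul]
        norm_num

end Energy

/-! ### Comparison of the two solutions. -/

section Comparison

variable {Ω Ω' : Set (Space N)} {A : Space N → Matrix (Fin N) (Fin N) ℝ} {M : ℝ}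

theorem setIntegral_eq_of_subset_of_zero {F : Type*} [NormedAddCommGroup F] [NormedSpace ℝ F]
    {s t : Set (Space N)} (ht : MeasurableSet t) (hst : s ⊆ t) {g : Space N → F}
    (hg : ∀ x ∉ s, g x = 0) : ∫ x in t, g x = ∫ x in s, g x :=
  setIntegral_eq_of_subset_of_forall_sdiff_eq_zero ht hst fun x hx => hg x hx.2

/-- The difference of the gradients of two solutions is orthogonal to the gradients of functions
which are admissible on both domains. -/
theorem integral_sesqForm_sub_eq_zero (hΩ : IsOpen Ω) (hΩ' : IsOpen Ω') (hM : 0 < M)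
    (hAm : ∀ i j, AEMeasurable (fun x => A x i j) (volume.restrict (Ω ∪ Ω')))
    (hA : ∀ᵐ x ∂(volume.restrict (Ω ∪ Ω')), IsEllipticMatrix (A x) M)
    {f u u' : Space N → 𝕜} {Du Du' : Space N → Vec 𝕜 N} (hu : IsDirichletSolution A f Ω u Du)
    (hu' : IsDirichletSolution A f Ω' u' Du') {K : ℝ≥0} {w : Space N → 𝕜}
    (hw : LipschitzWith K w) (hwc : HasCompactSupport w) (hws : tsupport w ⊆ Ω ∩ Ω') :
    ∫ x in Ω ∪ Ω', sesqForm (A x) ((Ω'.indicator Du' - Ω.indicator Du) x) (grad w x) = 0 := by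
  have hUm : MeasurableSet (Ω ∪ Ω') := (hΩ.union hΩ').measurableSet
  have hD : MemLp (Ω.indicator Du) 2 (volume.restrict (Ω ∪ Ω')) :=
    ((memLp_indicator_iff_restrict hΩ.measurableSet).2 hu.memH10.memLp_grad).mono_measure
      Measure.restrict_le_self
  have hD' : MemLp (Ω'.indicator Du') 2 (volume.restrict (Ω ∪ Ω')) :=
    ((memLp_indicator_iff_restrict hΩ'.measurableSet).2 hu'.memH10.memLp_grad).mono_measure
      Measure.restrict_le_self
  have hg : MemLp (grad w) 2 (volume.restrict (Ω ∪ Ω')) := memLp_grad hw hwc 2 _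
  have h1 := hu.weak_eq w (grad w)
    (memH10_of_lipschitzWith hΩ hw hwc (hws.trans Set.inter_subset_left))
  have h1' := hu'.weak_eq w (grad w)
    (memH10_of_lipschitzWith hΩ' hw hwc (hws.trans Set.inter_subset_right))
  have hrhs : ∫ x in Ω, f x * (starRingEnd 𝕜) (w x) = ∫ x in Ω', f x * (starRingEnd 𝕜) (w x) := by
    have hz : ∀ x ∉ Ω ∩ Ω', f x * (starRingEnd 𝕜) (w x) = 0 := fun x hx => by
      rw [image_eq_zero_of_notMem_tsupport fun h => hx (hws h), map_zero, mul_zero]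
    rw [setIntegral_eq_of_subset_of_zero hΩ.measurableSet Set.inter_subset_left hz,
      setIntegral_eq_of_subset_of_zero hΩ'.measurableSet Set.inter_subset_right hz]
  have hlhs : ∀ (V : Set (Space N)) (D : Space N → Vec 𝕜 N), MeasurableSet V → V ⊆ Ω ∪ Ω' →
      ∫ x in Ω ∪ Ω', sesqForm (A x) (V.indicator D x) (grad w x) =
        ∫ x in V, sesqForm (A x) (D x) (grad w x) := by
    intro V D hV hVU
    rw [setIntegral_eq_of_subset_of_zero hUm hVU fun x hx => by
      rw [Set.indicator_of_notMem hx, sesqForm_zero_left]]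
    exact setIntegral_congr_fun hV fun x hx => by simp only [Set.indicator_of_mem hx]
  simp only [Pi.sub_apply, sesqForm_sub_left]
  rw [integral_sub (integrable_sesqForm hM hAm hA hD' hg) (integrable_sesqForm hM hAm hA hD hg),
    hlhs Ω' Du' hΩ'.measurableSet Set.subset_union_right,
    hlhs Ω Du hΩ.measurableSet Set.subset_union_left]
  exact sub_eq_zero.2 ((h1'.trans hrhs.symm).trans h1.symm)

theorem eLpNorm_indicator_sub_grad {v : Space N → 𝕜} {D : Space N → Vec 𝕜 N} (hΩ : IsOpen Ω)
    (hv : IsTestFunction Ω v) :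
    eLpNorm (Ω.indicator D - grad v) 2 volume = eLpNorm (grad v - D) 2 (volume.restrict Ω) := by
  have h : Ω.indicator D - grad v = Ω.indicator (D - grad v) := by
    ext1 x
    by_cases hx : x ∈ Ω
    · simp [hx]
    · simp [hx, grad_eq_zero_of_notMem_tsupport fun h => hx (hv.tsupport_subset h)]
  rw [h, eLpNorm_indicator_eq_eLpNorm_restrict hΩ.measurableSet, ← eLpNorm_neg, neg_sub]

/-- The truncation of a test function `v` approximates a field `D` on `Ω` as well as `grad v`
does, up to the norm of `D` on the set of points moved by `φ`. -/
theorem eLpNorm_indicator_sub_grad_truncation_le {φ ψ : Space N → Space N}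
    (h : IsLipschitzPair φ ψ Ω Ω' M) (hM : 0 < M) {v : Space N → 𝕜} (hv : IsTestFunction Ω v)
    {D : Space N → Vec 𝕜 N} (hD : MemLp D 2 (volume.restrict Ω)) :
    eLpNorm (Ω.indicator D - grad (IsLipschitzPair.truncation ψ Ω' v)) 2 volume ≤
      (1 + IsLipschitzPair.truncationConst N M) * eLpNorm (grad v - D) 2 (volume.restrict Ω) +
        IsLipschitzPair.truncationConst N M *
          eLpNorm D 2 (volume.restrict {x ∈ Ω | φ x ≠ x}) := by
  have hE : {x ∈ Ω | φ x ≠ x} ⊆ Ω := Set.sep_subset _ _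
  have hDm := (aestronglyMeasurable_indicator_iff h.isOpen_source.measurableSet).2 hD.1
  have h1 : Ω.indicator D - grad (IsLipschitzPair.truncation ψ Ω' v) =
      (Ω.indicator D - grad v) + (grad v - grad (IsLipschitzPair.truncation ψ Ω' v)) := by abel
  -- On the moved set `grad v` is traded for `D`, at the cost of the approximation error.
  have h2 : eLpNorm (grad v) 2 (volume.restrict {x ∈ Ω | φ x ≠ x}) ≤
      eLpNorm (grad v - D) 2 (volume.restrict Ω) +
        eLpNorm D 2 (volume.restrict {x ∈ Ω | φ x ≠ x}) := by
    calc eLpNorm (grad v) 2 (volume.restrict {x ∈ Ω | φ x ≠ x})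
        = eLpNorm ((grad v - D) + D) 2 (volume.restrict {x ∈ Ω | φ x ≠ x}) := by
          rw [sub_add_cancel]
      _ ≤ _ := eLpNorm_add_le ((aestronglyMeasurable_grad _ _).sub
          (hD.1.mono_measure (Measure.restrict_mono_set _ hE)))
          (hD.1.mono_measure (Measure.restrict_mono_set _ hE)) (by norm_num)
      _ ≤ _ := by
          gcongr
  rw [h1]
  calc _ ≤ eLpNorm (Ω.indicator D - grad v) 2 volume +
        eLpNorm (grad v - grad (IsLipschitzPair.truncation ψ Ω' v)) 2 volume :=
        eLpNorm_add_le (hDm.sub (aestronglyMeasurable_grad _ _))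
          ((aestronglyMeasurable_grad _ _).sub (aestronglyMeasurable_grad _ _)) (by norm_num)
    _ ≤ eLpNorm (grad v - D) 2 (volume.restrict Ω) + IsLipschitzPair.truncationConst N M *
        (eLpNorm (grad v - D) 2 (volume.restrict Ω) +
          eLpNorm D 2 (volume.restrict {x ∈ Ω | φ x ≠ x})) := by
        rw [eLpNorm_indicator_sub_grad h.isOpen_source hv]
        gcongr
        exact (h.eLpNorm_grad_sub_truncation_le hM hv).trans (by gcongr)
    _ = _ := by ring

/-- Hölder's inequality on `E`; the exponent is `1/2 - 1/q`. -/
theorem eLpNorm_two_le_mul_volume_rpow {D : Space N → Vec 𝕜 N} {E : Set (Space N)} {q : ℝ}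
    (hq : 2 < q) (hE : E ⊆ Ω) (hD : AEStronglyMeasurable D (volume.restrict Ω)) {C : ℝ≥0∞}
    (hC : eLpNorm D (ENNReal.ofReal q) (volume.restrict Ω) ≤ C) :
    eLpNorm D 2 (volume.restrict E) ≤ C * volume E ^ ((q - 2) / (2 * q)) := by
  have hle : (2 : ℝ≥0∞) ≤ ENNReal.ofReal q := by
    rw [← ENNReal.ofReal_ofNat]
    exact ENNReal.ofReal_le_ofReal hq.le
  have h1 := eLpNorm_le_eLpNorm_mul_rpow_measure_univ hle
    (hD.mono_measure (Measure.restrict_mono_set volume hE))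
  have hexp : 1 / (2 : ℝ≥0∞).toReal - 1 / (ENNReal.ofReal q).toReal = (q - 2) / (2 * q) := by
    rw [ENNReal.toReal_ofReal (by linarith)]
    simp only [ENNReal.toReal_ofNat]
    field_simp
  rw [hexp, Measure.restrict_apply_univ] at h1
  refine h1.trans ?_
  gcongr
  exact (eLpNorm_mono_measure _ (Measure.restrict_mono_set volume hE)).trans hC

/-- Used to bound `(M ^ N) ^ θ` uniformly in `θ`, so that the final constant does not depend on `q`.
-/
theorem rpow_le_one_add {x : ℝ≥0∞} {θ : ℝ} (h0 : 0 ≤ θ) (h1 : θ ≤ 1) : x ^ θ ≤ 1 + x := by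
  rcases le_total x 1 with hx | hx
  · exact (ENNReal.rpow_le_one hx h0).trans le_self_add
  · calc x ^ θ ≤ x ^ (1 : ℝ) := ENNReal.rpow_le_rpow_of_exponent_le hx h1
      _ = x := ENNReal.rpow_one x
      _ ≤ 1 + x := le_add_self

/-- The stability estimate for the gradients, for mutually inverse Lipschitz maps. -/
theorem eLpNorm_sub_le_of_isLipschitzPair {φ ψ : Space N → Space N}
    (h : IsLipschitzPair φ ψ Ω Ω' M) (hM : 0 < M) (hA : IsEllipticOn A (Ω ∪ Ω') M)
    {f u u' : Space N → 𝕜} {Du Du' : Space N → Vec 𝕜 N} (hu : IsDirichletSolution A f Ω u Du)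
    (hu' : IsDirichletSolution A f Ω' u' Du') :
    eLpNorm (Ω'.indicator Du' - Ω.indicator Du) 2 (volume.restrict (Ω ∪ Ω')) ≤
      ENNReal.ofReal (N ^ 2 * M ^ 2) * (IsLipschitzPair.truncationConst N M *
        (eLpNorm Du' 2 (volume.restrict {x ∈ Ω' | ψ x ≠ x}) +
          eLpNorm Du 2 (volume.restrict {x ∈ Ω | φ x ≠ x}))) := by
  have hΩ := h.isOpen_source
  have hΩ' := h.isOpen_target
  obtain ⟨v, hv, -, hvlim⟩ := hu.memH10.exists_approx
  obtain ⟨v', hv', -, hvlim'⟩ := hu'.memH10.exists_approx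
  have hAe : ∀ᵐ x ∂(volume.restrict (Ω ∪ Ω')), IsEllipticMatrix (A x) M := by
    filter_upwards [ae_restrict_mem (hΩ.union hΩ').measurableSet] with x hx
    exact ⟨hA.symm x hx, hA.lower x hx, hA.upper x hx⟩
  have hD := (memLp_indicator_iff_restrict hΩ.measurableSet).2 hu.memH10.memLp_grad
  have hD' := (memLp_indicator_iff_restrict hΩ'.measurableSet).2 hu'.memH10.memLp_grad
  set C := IsLipschitzPair.truncationConst N M
  have hCtop : C ≠ ⊤ := IsLipschitzPair.truncationConst_ne_top N M
  set δ : ℕ → ℝ≥0∞ := fun n => eLpNorm (grad (v n) - Du) 2 (volume.restrict Ω)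
  set δ' : ℕ → ℝ≥0∞ := fun n => eLpNorm (grad (v' n) - Du') 2 (volume.restrict Ω')
  set d := eLpNorm Du 2 (volume.restrict {x ∈ Ω | φ x ≠ x})
  set d' := eLpNorm Du' 2 (volume.restrict {x ∈ Ω' | ψ x ≠ x})
  have hbound : ∀ n, eLpNorm (Ω'.indicator Du' - Ω.indicator Du) 2 (volume.restrict (Ω ∪ Ω')) ≤
      ENNReal.ofReal (N ^ 2 * M ^ 2) *
        (((1 + C) * δ' n + C * d') + ((1 + C) * δ n + C * d)) := by
    intro n
    obtain ⟨K, hK⟩ := h.exists_lipschitzWith_truncation (hv n)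
    obtain ⟨K', hK'⟩ := h.symm.exists_lipschitzWith_truncation (hv' n)
    set w := IsLipschitzPair.truncation ψ Ω' (v n)
    set w' := IsLipschitzPair.truncation φ Ω (v' n)
    have hwc : HasCompactSupport w := IsLipschitzPair.hasCompactSupport_truncation (hv n)
    have hwc' : HasCompactSupport w' := IsLipschitzPair.hasCompactSupport_truncation (hv' n)
    have hws : tsupport w ⊆ Ω ∩ Ω' := h.tsupport_truncation_subset (hv n)
    have hws' : tsupport w' ⊆ Ω ∩ Ω' := by
      rw [Set.inter_comm]
      exact h.symm.tsupport_truncation_subset (hv' n)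
    have hG := memLp_grad hK hwc 2 (volume.restrict (Ω ∪ Ω'))
    have hG' := memLp_grad hK' hwc' 2 (volume.restrict (Ω ∪ Ω'))
    have hT : MemLp (Ω'.indicator Du' - Ω.indicator Du) 2 (volume.restrict (Ω ∪ Ω')) :=
      (hD'.sub hD).mono_measure Measure.restrict_le_self
    -- The Céa competitor is `grad w' - grad w`, one truncation for each solution.
    have horth : ∫ x in Ω ∪ Ω', sesqForm (A x) ((Ω'.indicator Du' - Ω.indicator Du) x)
        ((grad w' - grad w) x) = 0 := by
      have e1 := integral_sesqForm_sub_eq_zero hΩ hΩ' hM hA.measurable hAe hu hu' hK hwc hws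
      have e2 := integral_sesqForm_sub_eq_zero hΩ hΩ' hM hA.measurable hAe hu hu' hK' hwc' hws'
      simp only [Pi.sub_apply (grad w'), sesqForm_sub_right]
      rw [integral_sub (integrable_sesqForm hM hA.measurable hAe hT hG')
        (integrable_sesqForm hM hA.measurable hAe hT hG), e1, e2, sub_zero]
    refine (eLpNorm_le_of_integral_sesqForm_eq_zero hM hA.measurable hAe hT (hG'.sub hG)
      horth).trans ?_
    gcongr
    have hsplit : Ω'.indicator Du' - Ω.indicator Du - (grad w' - grad w) =
        (Ω'.indicator Du' - grad w') - (Ω.indicator Du - grad w) := by abel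
    rw [hsplit]
    refine (eLpNorm_mono_measure _ Measure.restrict_le_self).trans ?_
    refine (eLpNorm_sub_le (hD'.1.sub (aestronglyMeasurable_grad _ _))
      (hD.1.sub (aestronglyMeasurable_grad _ _)) (by norm_num)).trans ?_
    exact add_le_add
      (eLpNorm_indicator_sub_grad_truncation_le h.symm hM (hv' n) hu'.memH10.memLp_grad)
      (eLpNorm_indicator_sub_grad_truncation_le h hM (hv n) hu.memH10.memLp_grad)
  -- The left side does not involve `n`, so only the errors `δ n`, `δ' n` need to tend to zero; the
  -- truncations need not converge.
  refine ge_of_tendsto' (f := fun n => ENNReal.ofReal (N ^ 2 * M ^ 2) *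
        (((1 + C) * δ' n + C * d') + ((1 + C) * δ n + C * d))) (x := atTop) ?_ hbound
  have h1C : 1 + C ≠ ⊤ := ENNReal.add_ne_top.2 ⟨ENNReal.one_ne_top, hCtop⟩
  have hlim : ∀ {ε : ℕ → ℝ≥0∞} {e : ℝ≥0∞}, Tendsto ε atTop (𝓝 0) →
      Tendsto (fun n => (1 + C) * ε n + C * e) atTop (𝓝 (C * e)) := by
    intro ε e hε
    have := (ENNReal.Tendsto.const_mul hε (Or.inr h1C)).add
      (tendsto_const_nhds (x := C * e))
    simpa using this
  have := ENNReal.Tendsto.const_mul ((hlim (e := d') hvlim').add (hlim (e := d) hvlim))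
    (a := ENNReal.ofReal (N ^ 2 * M ^ 2)) (Or.inr ENNReal.ofReal_ne_top)
  rwa [← mul_add] at this

end Comparison

end DomainPerturbation

/-! ### The estimate in terms of `|E|`. -/

theorem theorem2 {𝕜 : Type} [RCLike 𝕜] (N : ℕ) (M : ℝ) (hM : 0 < M) :
    ∃ c : ℝ≥0, ∀ (Ω Ω' : Set (DomainPerturbation.Space N))
      (φ : DomainPerturbation.Space N → DomainPerturbation.Space N)
      (A : DomainPerturbation.Space N → Matrix (Fin N) (Fin N) ℝ)
      (f u u' : DomainPerturbation.Space N → 𝕜)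
      (Du Du' : DomainPerturbation.Space N → DomainPerturbation.Vec 𝕜 N) (q : ℝ),
      DomainPerturbation.IsBoundedDomain Ω →
      DomainPerturbation.IsBoundedDomain Ω' →
      DomainPerturbation.IsBiLipschitzOnto φ Ω Ω' →
      DomainPerturbation.HasDerivBounds φ Ω M →
      DomainPerturbation.IsEllipticOn A (Ω ∪ Ω') M →
      MemLp f 2 (volume.restrict (Ω ∪ Ω')) →
      DomainPerturbation.IsDirichletSolution A f Ω u Du →
      DomainPerturbation.IsDirichletSolution A f Ω' u' Du' →
      2 < q →
      eLpNorm f (ENNReal.ofReal q) (volume.restrict (Ω ∪ Ω')) ≤ ENNReal.ofReal M →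
      eLpNorm Du (ENNReal.ofReal q) (volume.restrict Ω) ≤ ENNReal.ofReal M →
      eLpNorm Du' (ENNReal.ofReal q) (volume.restrict Ω') ≤ ENNReal.ofReal M →
      eLpNorm (Ω'.indicator Du' - Ω.indicator Du) 2 (volume.restrict (Ω ∪ Ω')) ≤
        (c : ℝ≥0∞) * volume {x ∈ Ω | φ x ≠ x} ^ ((q - 2) / (2 * q)) := by
  -- Céa's constant times the truncation constant times `M`; the summand `1 + M ^ N` comes from
  -- `Ω'`, the last `1` from `Ω`.
  set c : ℝ≥0∞ := ENNReal.ofReal (N ^ 2 * M ^ 2) *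
    (DomainPerturbation.IsLipschitzPair.truncationConst N M *
      (ENNReal.ofReal M * ((1 + ENNReal.ofReal (M ^ N)) + 1))) with hc
  have hctop : c ≠ ⊤ := by
    have := DomainPerturbation.IsLipschitzPair.truncationConst_ne_top N M
    finiteness
  refine ⟨c.toNNReal, ?_⟩
  intro Ω Ω' φ A f u u' Du Du' q hΩ hΩ' hφ hφM hA _ hu hu' hq _ hDu hDu'
  rw [ENNReal.coe_toNNReal hctop]
  obtain ⟨ψ, h⟩ := DomainPerturbation.exists_isLipschitzPair hΩ.isOpen hΩ'.isOpen hφ hφM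
  refine (DomainPerturbation.eLpNorm_sub_le_of_isLipschitzPair h hM hA hu hu').trans ?_
  have h1 := DomainPerturbation.eLpNorm_two_le_mul_volume_rpow (E := {x ∈ Ω | φ x ≠ x}) hq
    (Set.sep_subset _ _) hu.memH10.memLp_grad.1 hDu
  have h2 := DomainPerturbation.eLpNorm_two_le_mul_volume_rpow (E := {x ∈ Ω' | ψ x ≠ x}) hq
    (Set.sep_subset _ _) hu'.memH10.memLp_grad.1 hDu'
  have hθ0 : 0 ≤ (q - 2) / (2 * q) := div_nonneg (by linarith) (by linarith)
  have hθ1 : (q - 2) / (2 * q) ≤ 1 := by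
    rw [div_le_one (by linarith)]
    linarith
  have hvol : volume {x ∈ Ω' | ψ x ≠ x} ^ ((q - 2) / (2 * q)) ≤
      (1 + ENNReal.ofReal (M ^ N)) * volume {x ∈ Ω | φ x ≠ x} ^ ((q - 2) / (2 * q)) := by
    rw [← h.image_moved]
    refine (ENNReal.rpow_le_rpow (h.volume_image_le h.isOpen_moved.measurableSet
      (Set.sep_subset _ _)) hθ0).trans ?_
    rw [ENNReal.mul_rpow_of_nonneg _ _ hθ0]
    gcongr
    exact DomainPerturbation.rpow_le_one_add hθ0 hθ1
  calc _ ≤ ENNReal.ofReal (N ^ 2 * M ^ 2) *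
      (DomainPerturbation.IsLipschitzPair.truncationConst N M *
        (ENNReal.ofReal M * ((1 + ENNReal.ofReal (M ^ N)) *
          volume {x ∈ Ω | φ x ≠ x} ^ ((q - 2) / (2 * q))) +
        ENNReal.ofReal M * volume {x ∈ Ω | φ x ≠ x} ^ ((q - 2) / (2 * q)))) := by
        gcongr
        exact h2.trans (by gcongr)
    _ = _ := by
        rw [hc]
        ring
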